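/- Let $\Gamma$ and $G$ be finite connected graphs (regarded as topological spaces, i.e. finite connected CW complexes of dimension at most one), with arbitrary base points $x_0\in\Gamma$ and $y_0\in G$, let $\tau\colon\Gamma\to\Gamma$ be a free involution (a continuous map with $\tau\circ\tau=\mathrm{id}$ and without fixed points; it need not preserve the base point), and let $[\Gamma,G]$ be the set of based homotopy classes of based maps $(\Gamma,x_0)\to(G,y_0)$, homotopies being relative to the base point. The Borsuk–Ulam property is said to hold for $\alpha\in[\Gamma,G]$ if every based map $f$ representing $\alpha$ satisfies $f(x)=f(\tau x)$ for some $x\in\Gamma$. If $G$ is not a single point and is homeomorphic neither to the circle $S^1$ nor to the interval $[0,1]$, then the Borsuk–Ulam property fails for every $\alpha\in[\Gamma,G]$; that is, every $\alpha\in[\Gamma,G]$ has a representative $f$ with $f(x)\neq f(\tau x)$ for all $x\in\Gamma$. -/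

import Mathlib

universe u v

/-- `X` is (the underlying space of) a finite graph: a Hausdorff space that carries the structure
of a finite CW complex all of whose cells have dimension at most one. Loops and multiple edges
are allowed. -/
structure IsFiniteGraph (X : Type u) [TopologicalSpace X] : Prop where
  t2Space : T2Space X
  exists_cwComplex : ∃ _ : Topology.CWComplex (Set.univ : Set X),
    Topology.CWComplex.Finite (Set.univ : Set X) ∧
      ∀ n : ℕ, 2 ≤ n → IsEmpty (Topology.CWComplex.cell (Set.univ : Set X) n)

/-- A free involution: a continuous self-map of order two without fixed points. -/
structure IsFreeInvolution {X : Type u} [TopologicalSpace X] (τ : C(X, X)) : Prop where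
  involutive : ∀ x, τ (τ x) = x
  free : ∀ x, τ x ≠ x

/-- Continuous maps `X → Y` that send the base point `x₀` to the base point `y₀`. -/
abbrev BasedMap (X : Type u) [TopologicalSpace X] (x₀ : X) (Y : Type v) [TopologicalSpace Y]
    (y₀ : Y) : Type (max u v) :=
  {f : C(X, Y) // f x₀ = y₀}

/-- Based homotopy of based maps: homotopy relative to the base point. -/
def basedHomotopySetoid (X : Type u) [TopologicalSpace X] (x₀ : X) (Y : Type v)
    [TopologicalSpace Y] (y₀ : Y) : Setoid (BasedMap X x₀ Y y₀) where
  r f g := ContinuousMap.HomotopicRel f.1 g.1 {x₀}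
  iseqv :=
    ⟨fun f => ContinuousMap.HomotopicRel.refl f.1, fun h => h.symm, fun h h' => h.trans h'⟩

/-- The set `[X, Y]` of based homotopy classes of based maps `(X, x₀) → (Y, y₀)`. -/
def BasedHomotopyClass (X : Type u) [TopologicalSpace X] (x₀ : X) (Y : Type v)
    [TopologicalSpace Y] (y₀ : Y) : Type (max u v) :=
  Quotient (basedHomotopySetoid X x₀ Y y₀)

/-- `f` is a representative of the based homotopy class `α`. -/
def BasedMap.Represents {X : Type u} [TopologicalSpace X] {x₀ : X} {Y : Type v}
    [TopologicalSpace Y] {y₀ : Y} (f : BasedMap X x₀ Y y₀)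
    (α : BasedHomotopyClass X x₀ Y y₀) : Prop :=
  Quotient.mk (basedHomotopySetoid X x₀ Y y₀) f = α

/-- The Borsuk–Ulam property of a based homotopy class `α`, with respect to the involution `τ`:
every representative `f` of `α` satisfies `f x = f (τ x)` for some point `x`. -/
def BorsukUlamProperty {X : Type u} [TopologicalSpace X] {x₀ : X} {Y : Type v}
    [TopologicalSpace Y] {y₀ : Y} (τ : C(X, X)) (α : BasedHomotopyClass X x₀ Y y₀) : Prop :=
  ∀ f : BasedMap X x₀ Y y₀, f.Represents α → ∃ x : X, f.1 x = f.1 (τ x)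

/-!
A map `f` with `f x ≠ f (τ x)` for all `x` is the first component of a `τ`-equivariant map from `Γ`
to the space of ordered pairs of distinct points of `G`, on which the involution exchanges the two
points. The theorem holds because collisions of two particles that move on `G` can be avoided up to
homotopy: any two paths in `G` with distinct initial points and distinct final points are homotopic
relative to their end points to paths that are never at the same point at the same time
(`IsPassingPlace.separable`).

This needs only a *passing place* in `G`: a simply connected neighbourhood `U` of a point `c` in
which two particles can be moved between any two configurations. While the second particle is kept
in `U`, the first one can follow any path: cut the path into pieces inside `U`, where the passing
place takes care of the collisions, and pieces that avoid `c`, during which the second particle is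
parked at `c` (`IsPassingPlace.followable`). Any two particles can first be brought into `U`, and
there they take turns.

In a graph, the closed star of a vertex with at least three half-edges is a passing place
(`ArcDecomposition.IsEssential.exists_isPassingPlace`). Such a vertex exists, since otherwise the
arcs can be merged until a point, an interval or a circle is left
(`ArcDecomposition.exists_isEssential`).

On `Γ`, make the base point, the `0`-cells and their images under `τ` the vertices. Then `τ`
permutes the remaining open arcs, and fixes none of them, by the intermediate value theorem; so the
arcs come in pairs exchanged by `τ` (`ArcDecomposition.exists_equivariant`). Given `f`, first move
the values at the vertices, without changing the one at the base point, so that `f v ≠ f (τ v)`;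
then replace the restrictions of `f` to the two arcs of each pair by homotopic paths without
collisions.
-/

open Set unitInterval

/-! ### Collision-free pairs of paths -/

section CollisionFree

open Path

variable {X : Type v} [TopologicalSpace X]

/-- A pair of path classes is *separable* if it has representatives that never occupy the same
point at the same time: two particles can follow the two classes without a collision. -/
def Separable {a a' b b' : X} (x : Homotopic.Quotient a a') (y : Homotopic.Quotient b b') : Prop :=
  ∃ (γ : Path a a') (δ : Path b b'), Homotopic.Quotient.mk γ = x ∧ Homotopic.Quotient.mk δ = y ∧
      ∀ t, γ t ≠ δ t

namespace Separable

variable {a a' a'' b b' b'' : X}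

theorem trans {x : Homotopic.Quotient a a'} {y : Homotopic.Quotient b b'}
    {x' : Homotopic.Quotient a' a''}
    {y' : Homotopic.Quotient b' b''} (h : Separable x y) (h' : Separable x' y') :
    Separable (x.trans x') (y.trans y') := by
  obtain ⟨γ, δ, rfl, rfl, hne⟩ := h
  obtain ⟨γ', δ', rfl, rfl, hne'⟩ := h'
  refine ⟨γ.trans γ', δ.trans δ', rfl, rfl, fun t => ?_⟩
  rw [Path.trans_apply, Path.trans_apply]
  split_ifs
  exacts [hne _, hne' _]

theorem symm {x : Homotopic.Quotient a a'} {y : Homotopic.Quotient b b'} (h : Separable x y) :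
    Separable x.symm y.symm := by
  obtain ⟨γ, δ, rfl, rfl, hne⟩ := h
  exact ⟨γ.symm, δ.symm, rfl, rfl, fun t => hne _⟩

theorem swap {x : Homotopic.Quotient a a'} {y : Homotopic.Quotient b b'} (h : Separable x y) :
    Separable y x := by
  obtain ⟨γ, δ, rfl, rfl, hne⟩ := h
  exact ⟨δ, γ, rfl, rfl, fun t => (hne t).symm⟩

end Separable

/-- A *passing place* around `c`: a simply connected neighbourhood `U` of `c` in which two
particles can be moved between any two configurations without a collision. -/
structure IsPassingPlace (U : Set X) (c : X) : Prop where
  isSimplyConnected : IsSimplyConnected U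
  mem_interior : c ∈ interior U
  nontrivial : U.Nontrivial
  joinedIn : ∀ p ∈ U, ∀ q ∈ U, ∀ p' ∈ U, ∀ q' ∈ U, p ≠ q → p' ≠ q' →
    JoinedIn {z : X × X | z.1 ∈ U ∧ z.2 ∈ U ∧ z.1 ≠ z.2} (p, q) (p', q')

/-- The class `x` can be followed by one particle while the other one stays in `U`, moving
between arbitrary prescribed positions there. -/
def FollowableOutside (U : Set X) {p p' : X} (x : Homotopic.Quotient p p') : Prop :=
  ∀ q ∈ U, ∀ q' ∈ U, p ≠ q → p' ≠ q' →
    ∃ δ : Path q q', (∀ t, δ t ∈ U) ∧ Separable x (Homotopic.Quotient.mk δ)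

theorem FollowableOutside.of_cast {U : Set X} {p p' r r' : X} {γ : Path p p'} {h : r = p}
    {h' : r' = p'} (hγ : FollowableOutside U (Homotopic.Quotient.mk (γ.cast h h'))) :
    FollowableOutside U (Homotopic.Quotient.mk γ) := by
  subst h h'
  exact hγ

namespace IsPassingPlace

variable {U : Set X} {c : X}

theorem mem (hU : IsPassingPlace U c) : c ∈ U := interior_subset hU.mem_interior

theorem exists_ne (hU : IsPassingPlace U c) (p : X) : ∃ q ∈ U, p ≠ q := by
  obtain ⟨q, hq, h⟩ := hU.nontrivial.exists_ne p
  exact ⟨q, hq, h.symm⟩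

theorem homotopic (hU : IsPassingPlace U c) {p p' : X} {γ γ' : Path p p'} (h : ∀ t, γ t ∈ U)
    (h' : ∀ t, γ' t ∈ U) : Homotopic.Quotient.mk γ = Homotopic.Quotient.mk γ' := by
  have := hU.isSimplyConnected.simplyConnectedSpace
  have hp : p ∈ U := by simpa using h 0
  have hp' : p' ∈ U := by simpa using h 1
  let g : Path (⟨p, hp⟩ : U) ⟨p', hp'⟩ :=
    { toFun := fun t => ⟨γ t, h t⟩, source' := by simp, target' := by simp }
  let g' : Path (⟨p, hp⟩ : U) ⟨p', hp'⟩ :=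
    { toFun := fun t => ⟨γ' t, h' t⟩, source' := by simp, target' := by simp }
  exact Homotopic.Quotient.eq.2 ((SimplyConnectedSpace.paths_homotopic g g').map
    ⟨Subtype.val, continuous_subtype_val⟩)

theorem exists_paths (hU : IsPassingPlace U c) {p q p' q' : X} (hp : p ∈ U) (hq : q ∈ U)
    (hp' : p' ∈ U) (hq' : q' ∈ U) (h : p ≠ q) (h' : p' ≠ q') :
    ∃ (γ : Path p p') (δ : Path q q'), (∀ t, γ t ∈ U) ∧ (∀ t, δ t ∈ U) ∧ ∀ t, γ t ≠ δ t := by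
  obtain ⟨Φ, hΦ⟩ := hU.joinedIn p hp q hq p' hp' q' hq' h h'
  exact ⟨Φ.map continuous_fst, Φ.map continuous_snd, fun t => (hΦ t).1, fun t => (hΦ t).2.1,
    fun t => (hΦ t).2.2⟩

theorem followable_of_mem (hU : IsPassingPlace U c) {p p' : X} (γ : Path p p')
    (h : ∀ t, γ t ∈ U) : FollowableOutside U (Homotopic.Quotient.mk γ) := by
  intro q hq q' hq' hne hne'
  have hp : p ∈ U := by simpa using h 0
  have hp' : p' ∈ U := by simpa using h 1
  obtain ⟨γ', δ, h1, h2, h3⟩ := hU.exists_paths hp hq hp' hq' hne hne'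
  exact ⟨δ, h2, γ', δ, hU.homotopic h1 h, rfl, h3⟩

/-- A particle in `U` can be parked at `c` while the other one rests at a point `p ≠ c`. -/
theorem exists_park (hU : IsPassingPlace U c) {p q : X} (hp : p ≠ c) (hq : q ∈ U) (h : p ≠ q) :
    ∃ δ : Path q c, (∀ t, δ t ∈ U) ∧
      Separable (Homotopic.Quotient.refl p) (Homotopic.Quotient.mk δ) := by
  by_cases hpU : p ∈ U
  · exact hU.followable_of_mem (Path.refl p) (fun _ => hpU) q hq c hU.mem h hp
  · obtain ⟨δ, hδ⟩ := hU.isSimplyConnected.isPathConnected.joinedIn q hq c hU.mem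
    exact ⟨δ, hδ, Path.refl p, δ, rfl, rfl, fun t e => hpU (by
      rw [Path.refl_apply] at e
      exact e ▸ hδ t)⟩

/-- While one particle follows a path that avoids `c`, the other one is parked at `c`. -/
theorem followable_of_ne (hU : IsPassingPlace U c) {p p' : X} (γ : Path p p')
    (h : ∀ t, γ t ≠ c) : FollowableOutside U (Homotopic.Quotient.mk γ) := by
  intro q hq q' hq' hne hne'
  have hp : p ≠ c := by simpa using h 0
  have hp' : p' ≠ c := by simpa using h 1
  obtain ⟨δ, hδ, s⟩ := hU.exists_park hp hq hne
  obtain ⟨δ', hδ', s'⟩ := hU.exists_park hp' hq' hne'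
  have sm : Separable (Homotopic.Quotient.mk γ) (Homotopic.Quotient.refl c) :=
      ⟨γ, Path.refl c, rfl, rfl, h⟩
  refine ⟨δ.trans δ'.symm, fun t => ?_, ?_⟩
  · rw [Path.trans_apply]
    split_ifs
    exacts [hδ _, hδ' _]
  · have e : (Homotopic.Quotient.refl p').symm = Homotopic.Quotient.refl p' := by
      rw [← Homotopic.Quotient.mk_refl, ← Homotopic.Quotient.mk_symm, Path.refl_symm]
    simpa [e] using (s.trans sm).trans s'.symm

theorem followable_trans (hU : IsPassingPlace U c) {p p' p'' : X} {x : Homotopic.Quotient p p'}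
    {x' : Homotopic.Quotient p' p''} (h : FollowableOutside U x) (h' : FollowableOutside U x') :
    FollowableOutside U (x.trans x') := by
  intro q hq q'' hq'' hne hne''
  obtain ⟨q', hq', hne'⟩ := hU.exists_ne p'
  obtain ⟨δ, hδ, s⟩ := h q hq q' hq' hne hne'
  obtain ⟨δ', hδ', s'⟩ := h' q' hq' q'' hq'' hne' hne''
  refine ⟨δ.trans δ', fun t => ?_, s.trans s'⟩
  rw [Path.trans_apply]
  split_ifs
  exacts [hδ _, hδ' _]

/-- Every path can be followed while the other particle stays in `U`: cut the path into pieces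
that lie in `U` or avoid `c`; during the latter the other particle is parked at `c`. -/
theorem followable [T1Space X] (hU : IsPassingPlace U c) {p p' : X} (x : Homotopic.Quotient p p') :
    FollowableOutside U x := by
  induction x with | mk γ
  obtain ⟨t, ht0, hmono, ⟨n, hn⟩, ht⟩ := exists_monotone_Icc_subset_open_cover_unitInterval
    (c := fun b : Bool => γ ⁻¹' (bif b then interior U else {c}ᶜ))
    (fun b => by
      cases b
      · exact isOpen_compl_singleton.preimage γ.continuous
      · exact isOpen_interior.preimage γ.continuous)
    (fun s _ => by
      by_cases h : γ s = c
      · exact mem_iUnion.2 ⟨true, by simpa [h] using hU.mem_interior⟩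
      · exact mem_iUnion.2 ⟨false, by simpa using h⟩)
  have piece : ∀ n, FollowableOutside U (Homotopic.Quotient.mk (γ.subpath (t n) (t (n + 1)))) := by
    intro n
    have hr := γ.range_subpath_of_le _ _ (hmono n.le_succ)
    obtain ⟨b, hb⟩ := ht n
    have key : ∀ s, γ.subpath (t n) (t (n + 1)) s ∈ (bif b then interior U else {c}ᶜ) := by
      intro s
      obtain ⟨r, hr, e⟩ := hr ▸ mem_range_self (f := γ.subpath (t n) (t (n + 1))) s
      rw [← e]
      exact hb hr
    cases b
    · exact hU.followable_of_ne _ key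
    · exact hU.followable_of_mem _ fun s => interior_subset (key s)
  have all : ∀ n, FollowableOutside U (Homotopic.Quotient.mk (γ.subpath (t 0) (t n))) := by
    intro n
    induction n with
    | zero =>
      rw [Path.subpath_self]
      intro q hq q' hq' h h'
      by_cases hp : γ (t 0) = c
      · exact hU.followable_of_mem (Path.refl _)
          (fun _ => by simpa [hp] using hU.mem) q hq q' hq' h h'
      · exact hU.followable_of_ne (Path.refl _) (fun _ => by simpa using hp) q hq q' hq' h h'
    | succ n ih =>
      rw [← Homotopic.Quotient.eq.2 ⟨Path.Homotopy.subpathTransSubpath γ (t 0) (t n) (t (n + 1))⟩]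
      exact hU.followable_trans ih (piece n)
  have := all n
  rw [hn n le_rfl, ht0, Path.subpath_zero_one] at this
  exact FollowableOutside.of_cast this

/-- Two distinct particles can be brought into `U` without a collision: on a path from one of
them to `c`, run the last piece that starts at either of them; then bring in the other one while
the first stays in `U`. -/
theorem exists_separable_to [T2Space X] [PathConnectedSpace X] (hU : IsPassingPlace U c) {a b : X}
    (hab : a ≠ b) :
    ∃ p ∈ U, ∃ q ∈ U, p ≠ q ∧ ∃ (x : Homotopic.Quotient a p) (y : Homotopic.Quotient b q),
        Separable x y := by
  -- one particle is taken to `c`, the other one rests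
  have key : ∀ a b : X, a ≠ b → (∃ γ : Path a c, ∀ t, γ t ≠ b) →
      ∃ p ∈ U, ∃ q ∈ U, p ≠ q ∧ ∃ (x : Homotopic.Quotient a p) (y : Homotopic.Quotient b q),
          Separable x y := by
    rintro a b hab ⟨γ, hγ⟩
    obtain ⟨r, hr, hcr⟩ := hU.exists_ne c
    have hbc : b ≠ c := by simpa using (hγ 1).symm
    have s : Separable (Homotopic.Quotient.mk γ) (Homotopic.Quotient.refl b) :=
      ⟨γ, Path.refl b, rfl, rfl, hγ⟩
    obtain ⟨δ, -, s'⟩ := hU.followable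
      (Homotopic.Quotient.mk (PathConnectedSpace.somePath b c)) c hU.mem r hr hbc hcr
    exact ⟨r, hr, c, hU.mem, hcr.symm, _, _, s.trans s'.swap⟩
  let γ := PathConnectedSpace.somePath a c
  let S : Set I := γ ⁻¹' {a, b}
  have hS : IsCompact S := ((toFinite _).isClosed.preimage γ.continuous).isCompact
  obtain ⟨t, htS, ht⟩ := hS.exists_isGreatest ⟨0, by simp [S]⟩
  have hlast : ∀ s, t < s → γ s ≠ a ∧ γ s ≠ b := by
    intro s hs
    by_contra hcon
    have : s ∈ S := by
      simp only [S, mem_preimage, mem_insert_iff, mem_singleton_iff]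
      tauto
    exact (ht this).not_gt hs
  have sub : ∀ z, z ∈ ({a, b} : Set X) → z ≠ γ t → ∀ s, γ.subpath t 1 s ≠ z := by
    intro z hz hzt s
    obtain ⟨r, hr, e⟩ := (γ.range_subpath_of_le t 1 le_one') ▸
      mem_range_self (f := γ.subpath t 1) s
    rw [← e]
    rcases hr.1.eq_or_lt with h | h
    · rw [← h]; exact hzt.symm
    · rcases hz with rfl | rfl
      exacts [(hlast r h).1, (hlast r h).2]
  rcases (htS : γ t = a ∨ γ t = b) with h | h
  · exact key a b hab ⟨(γ.subpath t 1).cast h.symm (by simp), fun s =>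
      sub b (by simp) (by rw [h]; exact hab.symm) s⟩
  · obtain ⟨p, hp, q, hq, hne, x, y, s⟩ := key b a hab.symm
      ⟨(γ.subpath t 1).cast h.symm (by simp), fun s =>
        sub a (by simp) (by rw [h]; exact hab) s⟩
    exact ⟨q, hq, p, hp, hne.symm, y, x, s.swap⟩

/-- In a space with a passing place every two path classes with distinct initial and distinct
final points can be followed simultaneously without a collision. -/
theorem separable [T2Space X] [PathConnectedSpace X] (hU : IsPassingPlace U c) {a a' b b' : X}
    (h : a ≠ b) (h' : a' ≠ b') (x : Homotopic.Quotient a a') (y : Homotopic.Quotient b b') :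
    Separable x y := by
  have inside : ∀ {p p' q q' : X}, p ∈ U → p' ∈ U → q ∈ U → q' ∈ U → p ≠ q → p' ≠ q' →
      ∀ (x : Homotopic.Quotient p p') (y : Homotopic.Quotient q q'), Separable x y := by
    intro p p' q q' hp hp' hq hq' hne hne' x y
    obtain ⟨m, hm, hmne⟩ := hU.exists_ne p'
    obtain ⟨δ, -, s⟩ := hU.followable x q hq m hm hne hmne
    -- the detour `δ` of the second particle is undone while the first one stays in `U`
    obtain ⟨ε, hε, s'⟩ := hU.followable ((Homotopic.Quotient.mk δ).symm.trans y) p' hp' p' hp'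
      hmne.symm hne'.symm
    have e : Homotopic.Quotient.mk ε = Homotopic.Quotient.refl p' :=
      hU.homotopic hε (γ' := Path.refl p') fun _ => hp'
    rw [e] at s'
    simpa [← Homotopic.Quotient.trans_assoc _ _ y] using s.trans s'.swap
  obtain ⟨p, hp, q, hq, hne, α, β, s⟩ := hU.exists_separable_to h
  obtain ⟨p', hp', q', hq', hne', α', β', s'⟩ := hU.exists_separable_to h'
  -- conjugate by the two motions into `U`
  have := (s.trans (inside hp hp' hq hq' hne hne' ((α.symm.trans x).trans α')
    ((β.symm.trans y).trans β'))).trans s'.symm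
  simpa [← Homotopic.Quotient.trans_assoc α, ← Homotopic.Quotient.trans_assoc β] using this

end IsPassingPlace

end CollisionFree

/-! ### Decompositions of a space into finitely many vertices and open arcs -/


/-- A decomposition of the space `X` into a finite set `V` of vertices and disjoint open arcs
`arc i '' Ioo 0 1`. The arcs are parametrized by continuous maps on the whole real line, of which
only the restrictions to `[0, 1]` matter; the two end points `arc i 0` and `arc i 1` are vertices
and may coincide. -/
structure ArcDecomposition (X : Type u) [TopologicalSpace X] (V : Set X) (ι : Type*) where
  arc : ι → ℝ → X
  continuous_arc : ∀ i, Continuous (arc i)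
  finite_vertices : V.Finite
  arc_zero_mem : ∀ i, arc i 0 ∈ V
  arc_one_mem : ∀ i, arc i 1 ∈ V
  arc_notMem : ∀ i, ∀ s ∈ Ioo (0 : ℝ) 1, arc i s ∉ V
  arc_injective : ∀ i j, ∀ s ∈ Ioo (0 : ℝ) 1, ∀ t ∈ Ioo (0 : ℝ) 1,
    arc i s = arc j t → i = j ∧ s = t
  exists_arc : ∀ x ∉ V, ∃ i, ∃ s ∈ Ioo (0 : ℝ) 1, arc i s = x

theorem mem_Icc_zero_one_cases {s : ℝ} (hs : s ∈ Icc (0 : ℝ) 1) :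
    s = 0 ∨ s = 1 ∨ s ∈ Ioo (0 : ℝ) 1 := by
  rcases hs.1.eq_or_lt with h | h
  · exact .inl h.symm
  · rcases hs.2.eq_or_lt with h' | h'
    exacts [.inr (.inl h'), .inr (.inr ⟨h, h'⟩)]

namespace ArcDecomposition

variable {X : Type u} [TopologicalSpace X] {V : Set X} {ι : Type*}

theorem arc_mem_iff (D : ArcDecomposition X V ι) (i : ι) {s : ℝ} (hs : s ∈ Icc (0 : ℝ) 1) :
    D.arc i s ∈ V ↔ s = 0 ∨ s = 1 := by
  constructor
  · intro h
    rcases mem_Icc_zero_one_cases hs with h0 | h1 | h2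
    exacts [.inl h0, .inr h1, (D.arc_notMem i s h2 h).elim]
  · rintro (rfl | rfl)
    exacts [D.arc_zero_mem i, D.arc_one_mem i]

theorem mem_or_exists_arc (D : ArcDecomposition X V ι) (x : X) :
    x ∈ V ∨ ∃ i, ∃ s ∈ Ioo (0 : ℝ) 1, D.arc i s = x :=
  or_iff_not_imp_left.2 (D.exists_arc x)

theorem isClosed_subset_vertices (D : ArcDecomposition X V ι) [T2Space X] {S : Set X} (hS : S ⊆ V) :
    IsClosed S :=
  (D.finite_vertices.subset hS).isClosed

theorem isCompact_arc (D : ArcDecomposition X V ι) (i : ι) : IsCompact (D.arc i '' Icc 0 1) :=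
  isCompact_Icc.image (D.continuous_arc i)

/-- A set that contains the closure of every open arc that it meets is closed. -/
theorem isClosed_subgraph (D : ArcDecomposition X V ι) [Finite ι] [T2Space X] {S : Set X}
    (h : ∀ i, (∀ s ∈ Icc (0 : ℝ) 1, D.arc i s ∈ S) ∨ ∀ s ∈ Ioo (0 : ℝ) 1, D.arc i s ∉ S) :
    IsClosed S := by
  have e : S = (S ∩ V) ∪ ⋃ i : {i // ∀ s ∈ Icc (0 : ℝ) 1, D.arc i s ∈ S},
      D.arc i.1 '' Icc 0 1 := by
    ext x
    constructor
    · intro hx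
      rcases D.mem_or_exists_arc x with hV | ⟨i, s, hs, rfl⟩
      · exact .inl ⟨hx, hV⟩
      · rcases h i with h | h
        · exact .inr (mem_iUnion.2 ⟨⟨i, h⟩, mem_image_of_mem _ (Ioo_subset_Icc_self hs)⟩)
        · exact (h s hs hx).elim
    · rintro (hx | hx)
      · exact hx.1
      · obtain ⟨⟨i, hi⟩, s, hs, rfl⟩ := mem_iUnion.1 hx
        exact hi s hs
  rw [e]
  exact (D.isClosed_subset_vertices inter_subset_right).union
    (isClosed_iUnion_of_finite fun i => (D.isCompact_arc i.1).isClosed)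

theorem isClopen_subgraph (D : ArcDecomposition X V ι) [Finite ι] [T2Space X] {S : Set X}
    (h : ∀ i, (∀ s ∈ Icc (0 : ℝ) 1, D.arc i s ∈ S) ∨ ∀ s ∈ Icc (0 : ℝ) 1, D.arc i s ∉ S) :
    IsClopen S := by
  refine ⟨D.isClosed_subgraph fun i => (h i).imp_right fun h s hs => h s (Ioo_subset_Icc_self hs),
    isClosed_compl_iff.1 (D.isClosed_subgraph fun i => ?_)⟩
  rcases h i with h | h
  · exact .inr fun s hs hn => hn (h s (Ioo_subset_Icc_self hs))
  · exact .inl h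

theorem isOpen_arc (D : ArcDecomposition X V ι) [Finite ι] [T2Space X] (i : ι) :
    IsOpen (D.arc i '' Ioo 0 1) := by
  rw [← isClosed_compl_iff]
  refine D.isClosed_subgraph fun j => ?_
  by_cases hij : i = j
  · subst hij
    exact .inr fun s hs hn => hn (mem_image_of_mem _ hs)
  · left
    rintro s hs ⟨t, ht, e⟩
    have : s ∈ Ioo (0 : ℝ) 1 := by
      rcases mem_Icc_zero_one_cases hs with rfl | rfl | h
      · exact (D.arc_notMem i t ht (e ▸ D.arc_zero_mem j)).elim
      · exact (D.arc_notMem i t ht (e ▸ D.arc_one_mem j)).elim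
      · exact h
    exact hij (D.arc_injective i j t ht s this e).1

theorem compactSpace (D : ArcDecomposition X V ι) [Finite ι] : CompactSpace X := by
  refine ⟨?_⟩
  have e : (univ : Set X) = V ∪ ⋃ i, D.arc i '' Icc 0 1 := by
    refine (eq_univ_of_forall fun x => ?_).symm
    rcases D.mem_or_exists_arc x with hV | ⟨i, s, hs, rfl⟩
    · exact .inl hV
    · exact .inr (mem_iUnion.2 ⟨i, mem_image_of_mem _ (Ioo_subset_Icc_self hs)⟩)
  rw [e]
  exact D.finite_vertices.isCompact.union (isCompact_iUnion D.isCompact_arc)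

theorem joined_arc (D : ArcDecomposition X V ι) (i : ι) (s t : ℝ) :
    Joined (D.arc i s) (D.arc i t) :=
  (PathConnectedSpace.joined s t).map (D.continuous_arc i)

theorem pathConnectedSpace (D : ArcDecomposition X V ι) [Finite ι] [T2Space X] [ConnectedSpace X] :
    PathConnectedSpace X := by
  obtain ⟨x₀⟩ := (inferInstance : Nonempty X)
  have hc : IsClopen {x | Joined x₀ x} := D.isClopen_subgraph fun i => by
    by_cases h : Joined x₀ (D.arc i 0)
    · exact .inl fun s _ => h.trans (D.joined_arc i 0 s)
    · exact .inr fun s _ hs => h (Joined.trans hs (D.joined_arc i s 0))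
  have hu := hc.eq_univ ⟨x₀, Joined.refl x₀⟩
  have key : ∀ x, Joined x₀ x := fun x => by
    have : x ∈ {x | Joined x₀ x} := hu ▸ mem_univ x
    exact this
  exact ⟨⟨x₀⟩, fun x y => (key x).symm.trans (key y)⟩

/-- Gluing: continuous families on the arcs and on the vertices, with parameters in `T`, that
agree at the end points of the arcs define a continuous map on `X × T`. -/
theorem exists_glue (D : ArcDecomposition X V ι) [Finite ι] [T2Space X] {T Y : Type*}
    [TopologicalSpace T] [CompactSpace T]
    [T2Space T] [TopologicalSpace Y] (g : ι → ℝ → T → Y)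
    (hg : ∀ i, Continuous fun p : ℝ × T => g i p.1 p.2) (c : X → T → Y)
    (hc : ∀ v ∈ V, Continuous (c v)) (h0 : ∀ i t, g i 0 t = c (D.arc i 0) t)
    (h1 : ∀ i t, g i 1 t = c (D.arc i 1) t) :
    ∃ H : C(X × T, Y), (∀ i, ∀ s ∈ Icc (0 : ℝ) 1, ∀ t, H (D.arc i s, t) = g i s t) ∧
      ∀ v ∈ V, ∀ t, H (v, t) = c v t := by
  classical
  choose i₀ s₀ hs₀ e₀ using D.exists_arc
  let F : X × T → Y := fun p => if h : p.1 ∈ V then c p.1 p.2 else g (i₀ p.1 h) (s₀ p.1 h) p.2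
  have hFV : ∀ v ∈ V, ∀ t, F (v, t) = c v t := fun v hv t => dif_pos hv
  have hF : ∀ i, ∀ s ∈ Icc (0 : ℝ) 1, ∀ t, F (D.arc i s, t) = g i s t := by
    intro i s hs t
    rcases mem_Icc_zero_one_cases hs with rfl | rfl | h
    · rw [hFV _ (D.arc_zero_mem i), h0]
    · rw [hFV _ (D.arc_one_mem i), h1]
    · have hn := D.arc_notMem i s h
      obtain ⟨ei, es⟩ := D.arc_injective _ _ _ (hs₀ _ hn) _ h (e₀ _ hn)
      change dite _ _ _ = _
      rw [dif_neg hn]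
      simp only [ei, es]
  refine ⟨⟨F, continuous_iff_isClosed.2 fun C hC => ?_⟩, hF, hFV⟩
  have e : F ⁻¹' C = (⋃ i, (fun p : ℝ × T => (D.arc i p.1, p.2)) ''
      ((Icc 0 1 ×ˢ univ) ∩ (fun p : ℝ × T => g i p.1 p.2) ⁻¹' C)) ∪
      ⋃ v ∈ V, (Prod.mk v) '' (c v ⁻¹' C) := by
    ext ⟨x, t⟩
    constructor
    · intro hx
      rcases D.mem_or_exists_arc x with hV | ⟨i, s, hs, rfl⟩
      · refine .inr (mem_iUnion₂.2 ⟨x, hV, t, ?_, rfl⟩)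
        rwa [mem_preimage, hFV x hV] at hx
      · have hs' := Ioo_subset_Icc_self hs
        refine .inl (mem_iUnion.2 ⟨i, (s, t), ⟨⟨hs', mem_univ _⟩, ?_⟩, rfl⟩)
        rwa [mem_preimage, hF i s hs'] at hx
    · rintro (hx | hx)
      · obtain ⟨i, ⟨s, t'⟩, ⟨⟨hs, -⟩, hm⟩, e⟩ := mem_iUnion.1 hx
        obtain ⟨rfl, rfl⟩ := Prod.mk.inj e
        rw [mem_preimage, hF i s hs]
        exact hm
      · obtain ⟨v, hv, t', hm, e⟩ := mem_iUnion₂.1 hx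
        obtain ⟨rfl, rfl⟩ := Prod.mk.inj e
        rw [mem_preimage, hFV _ hv]
        exact hm
  rw [e]
  refine IsClosed.union (isClosed_iUnion_of_finite fun i => ?_)
    (D.finite_vertices.isClosed_biUnion fun v hv => ?_)
  · refine (IsCompact.image ?_ ?_).isClosed
    · exact (isCompact_Icc.prod isCompact_univ).inter_right (hC.preimage (hg i))
    · exact ((D.continuous_arc i).comp continuous_fst).prodMk continuous_snd
  · exact ((hC.preimage (hc v hv)).isCompact.image (by fun_prop)).isClosed

/-- Gluing without parameters. -/
theorem exists_glue_map (D : ArcDecomposition X V ι) [Finite ι] [T2Space X] {Y : Type*}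
    [TopologicalSpace Y] (g : ι → ℝ → Y)
    (hg : ∀ i, Continuous (g i)) (c : X → Y) (h0 : ∀ i, g i 0 = c (D.arc i 0))
    (h1 : ∀ i, g i 1 = c (D.arc i 1)) :
    ∃ H : C(X, Y), (∀ i, ∀ s ∈ Icc (0 : ℝ) 1, H (D.arc i s) = g i s) ∧ ∀ v ∈ V, H v = c v := by
  obtain ⟨H, h, h'⟩ := D.exists_glue (T := Unit) (fun i s _ => g i s)
    (fun i => (hg i).comp continuous_fst) (fun x _ => c x) (fun _ _ => continuous_const)
    (fun i _ => h0 i) (fun i _ => h1 i)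
  exact ⟨H.comp ⟨fun x => (x, ()), by fun_prop⟩, fun i s hs => h i s hs (), fun v hv => h' v hv ()⟩

/-- A point inside an arc can be made a vertex. -/
theorem exists_subdivision (D : ArcDecomposition X V ι) {x : X} (hx : x ∉ V) :
    Nonempty (ArcDecomposition X (insert x V) (Option ι)) := by
  classical
  obtain ⟨i, t, ht, rfl⟩ := D.exists_arc x hx
  obtain ⟨ht0, ht1⟩ := ht
  -- every new arc is an affine reparametrization of an old one
  let old : Option ι → ι := fun o => o.elim i id
  let a : Option ι → ℝ := fun o => o.elim t fun _ => 0
  let b : Option ι → ℝ := fun o => o.elim 1 fun j => if j = i then t else 1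
  have ha : ∀ o, 0 ≤ a o := by rintro (_ | j) <;> simp [a, ht0.le]
  have hb : ∀ o, b o ≤ 1 := by
    rintro (_ | j)
    · simp [b]
    · change ite _ _ _ ≤ _
      split_ifs
      exacts [ht1.le, le_rfl]
  have hab : ∀ o, a o < b o := by
    rintro (_ | j)
    · simpa [a, b] using ht1
    · change 0 < ite _ _ _
      split_ifs
      exacts [ht0, one_pos]
  have ha_mem : ∀ o, D.arc (old o) (a o) ∈ insert (D.arc i t) V := by
    rintro (_ | j)
    exacts [.inl rfl, .inr (D.arc_zero_mem j)]
  have hb_mem : ∀ o, D.arc (old o) (b o) ∈ insert (D.arc i t) V := by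
    rintro (_ | j)
    · exact .inr (D.arc_one_mem i)
    · by_cases h : j = i
      · subst h; left; simp [old, b]
      · right; simpa [old, b, h] using D.arc_one_mem j
  have haff : ∀ o, ∀ s ∈ Ioo (0 : ℝ) 1, a o + (b o - a o) * s ∈ Ioo (a o) (b o) := by
    intro o s hs
    have := hab o
    constructor <;> nlinarith [hs.1, hs.2]
  have hsub : ∀ o, ∀ s ∈ Ioo (a o) (b o), s ∈ Ioo (0 : ℝ) 1 := fun o s hs =>
    ⟨(ha o).trans_lt hs.1, hs.2.trans_le (hb o)⟩
  have hold : ∀ o o', ∀ s ∈ Ioo (a o) (b o), s ∈ Ioo (a o') (b o') → old o = old o' → o = o' := by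
    rintro (_ | j) (_ | k) s hs hs' e
    · rfl
    · obtain rfl : i = k := e
      simp only [a, b, Option.elim, if_true] at hs hs'
      exact absurd hs.1 (not_lt.2 hs'.2.le)
    · obtain rfl : j = i := e
      simp only [a, b, Option.elim, if_true] at hs hs'
      exact absurd hs'.1 (not_lt.2 hs.2.le)
    · exact congrArg some e
  refine ⟨{
    arc := fun o s => D.arc (old o) (a o + (b o - a o) * s)
    continuous_arc := fun o => (D.continuous_arc _).comp (by fun_prop)
    finite_vertices := D.finite_vertices.insert _
    arc_zero_mem := fun o => by simpa using ha_mem o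
    arc_one_mem := fun o => by simpa using hb_mem o
    arc_notMem := ?_
    arc_injective := ?_
    exists_arc := ?_ }⟩
  · rintro o s hs (h | h)
    · have hs' := haff o s hs
      obtain ⟨e, e'⟩ := D.arc_injective _ _ _ (hsub o _ hs') _ ⟨ht0, ht1⟩ h
      rw [e'] at hs'
      rcases o with _ | j
      · exact lt_irrefl _ hs'.1
      · obtain rfl : j = i := e
        simp [b] at hs'
    · exact D.arc_notMem _ _ (hsub o _ (haff o s hs)) h
  · intro o o' s hs s' hs' h
    have h1 := haff o s hs
    have h2 := haff o' s' hs'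
    obtain ⟨e, e'⟩ := D.arc_injective _ _ _ (hsub o _ h1) _ (hsub o' _ h2) h
    have eo : o = o' := hold o o' _ h1 (e' ▸ h2) e
    subst eo
    refine ⟨rfl, ?_⟩
    have := hab o
    exact mul_left_cancel₀ (by linarith : b o - a o ≠ 0) (by linarith)
  · intro x hx
    simp only [mem_insert_iff, not_or] at hx
    obtain ⟨j, s, hs, rfl⟩ := D.exists_arc x hx.2
    have key : ∃ o, old o = j ∧ s ∈ Ioo (a o) (b o) := by
      by_cases h : j = i
      · subst h
        rcases lt_trichotomy s t with hst | rfl | hst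
        · exact ⟨some j, rfl, by simpa [a, b] using ⟨hs.1, hst⟩⟩
        · exact (hx.1 rfl).elim
        · exact ⟨none, rfl, by simpa [a, b] using ⟨hst, hs.2⟩⟩
      · exact ⟨some j, rfl, by simpa [a, b, h] using hs⟩
    obtain ⟨o, rfl, h1, h2⟩ := key
    have := hab o
    have hpos : 0 < b o - a o := by linarith
    refine ⟨o, (s - a o) / (b o - a o), ⟨div_pos (by linarith) hpos, ?_⟩, ?_⟩
    · rw [div_lt_one hpos]; linarith
    · rw [mul_div_cancel₀ _ hpos.ne']; congr 1; ring

/-- Finitely many additional points can be made vertices. -/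
theorem exists_union {X : Type u} [TopologicalSpace X] {V : Set X} {ι : Type} [Finite ι]
    (D : ArcDecomposition X V ι) {W : Set X} (hW : W.Finite) :
    ∃ κ : Type, Finite κ ∧ Nonempty (ArcDecomposition X (W ∪ V) κ) := by
  induction W, hW using Set.Finite.induction_on with
  | empty => exact ⟨ι, inferInstance, by simpa using ⟨D⟩⟩
  | @insert a W _ _ ih =>
    obtain ⟨κ, _, ⟨D'⟩⟩ := ih
    rw [insert_union]
    by_cases ha : a ∈ W ∪ V
    · rw [insert_eq_of_mem ha]; exact ⟨κ, inferInstance, ⟨D'⟩⟩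
    · exact ⟨Option κ, inferInstance, D'.exists_subdivision ha⟩

end ArcDecomposition

/-! ### Finite graphs as spaces with an arc decomposition -/

/-- A finite graph has a decomposition into the `0`-cells and the open `1`-cells. -/
theorem IsFiniteGraph.exists_arcDecomposition {X : Type u} [TopologicalSpace X]
    (hX : IsFiniteGraph X) :
    ∃ (V : Set X) (n : ℕ), Nonempty (ArcDecomposition X V (Fin n)) := by
  have := hX.t2Space
  obtain ⟨cw, hfin, hdim⟩ := hX.exists_cwComplex
  let C : Set X := univ
  have hf0 : Finite (Topology.RelCWComplex.cell C 0) :=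
    Topology.RelCWComplex.FiniteType.finite_cell (C := C) 0
  have hf1 : Finite (Topology.RelCWComplex.cell C 1) :=
    Topology.RelCWComplex.FiniteType.finite_cell (C := C) 1
  obtain ⟨n, ⟨en⟩⟩ := Finite.exists_equiv_fin (Topology.RelCWComplex.cell C 1)
  let m := fun (k : ℕ) (i : Topology.RelCWComplex.cell C k) => Topology.RelCWComplex.map k i
  let V : Set X := range fun i : Topology.RelCWComplex.cell C 0 => m 0 i 0
  have hball0 : ∀ x : Fin 0 → ℝ, x = 0 := fun x => Subsingleton.elim _ _
  -- the segment `[-1, 1]`, reparametrized to `[0, 1]` and extended to a constant outside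
  let p : ℝ → Fin 1 → ℝ := fun s _ => max (-1) (min 1 (2 * s - 1))
  have hpn : ∀ s, ‖p s‖ = |max (-1) (min 1 (2 * s - 1))| := fun s => by simp [p]
  have hp : ∀ s, p s ∈ Metric.closedBall (0 : Fin 1 → ℝ) 1 := by
    intro s
    rw [mem_closedBall_zero_iff, hpn, abs_le]
    exact ⟨le_max_left _ _, max_le (by norm_num) (min_le_left _ _)⟩
  have hps : ∀ s ∈ Ioo (0 : ℝ) 1, max (-1) (min 1 (2 * s - 1)) = 2 * s - 1 := by
    intro s hs
    rw [min_eq_right (by linarith [hs.2]), max_eq_right (by linarith [hs.1])]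
  have hpo : ∀ s ∈ Ioo (0 : ℝ) 1, p s ∈ Metric.ball (0 : Fin 1 → ℝ) 1 := by
    intro s hs
    rw [mem_ball_zero_iff, hpn, hps s hs, abs_lt]
    constructor <;> linarith [hs.1, hs.2]
  have hsph : ∀ i, ∀ s : ℝ, ‖p s‖ = 1 → m 1 i (p s) ∈ V := by
    intro i s hs
    obtain ⟨J, hJ⟩ := Topology.CWComplex.mapsTo (C := C) 1 i
    have := hJ (mem_sphere_zero_iff_norm.2 hs)
    simp only [mem_iUnion] at this
    obtain ⟨k, hk, j, -, y, -, e⟩ := this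
    obtain rfl : k = 0 := by omega
    exact ⟨j, by rw [← e, hball0 y]⟩
  have hdisj : ∀ (k l : ℕ) (i : Topology.RelCWComplex.cell C k) (j : Topology.RelCWComplex.cell C l)
      (x : Fin k → ℝ) (y : Fin l → ℝ), x ∈ Metric.ball (0 : Fin k → ℝ) 1 →
      y ∈ Metric.ball (0 : Fin l → ℝ) 1 → m k i x = m l j y →
      (⟨k, i⟩ : Σ k, Topology.RelCWComplex.cell C k) = ⟨l, j⟩ := by
    intro k l i j x y hx hy e
    by_contra hne
    exact disjoint_left.1 (Topology.CWComplex.disjoint_openCell_of_ne hne)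
      (mem_image_of_mem _ hx) (e ▸ mem_image_of_mem _ hy)
  refine ⟨V, n, ⟨{
    arc := fun i s => m 1 (en.symm i) (p s)
    continuous_arc := fun i => (Topology.RelCWComplex.continuousOn 1 _).comp_continuous
      (by fun_prop) hp
    finite_vertices := finite_range _
    arc_zero_mem := fun i => hsph _ _ (by rw [hpn]; norm_num)
    arc_one_mem := fun i => hsph _ _ (by rw [hpn]; norm_num)
    arc_notMem := ?_
    arc_injective := ?_
    exists_arc := ?_ }⟩⟩
  · rintro i s hs ⟨j, e⟩
    have := hdisj 0 1 j (en.symm i) 0 (p s) (by simp) (hpo s hs) e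
    simpa using congrArg Sigma.fst this
  · intro i j s hs t ht e
    have h := hdisj 1 1 _ _ _ _ (hpo s hs) (hpo t ht) e
    obtain rfl : i = j := by simpa using h
    refine ⟨rfl, ?_⟩
    have h2 := (m 1 (en.symm i)).injOn
      (by rw [Topology.RelCWComplex.source_eq]; exact hpo s hs)
      (by rw [Topology.RelCWComplex.source_eq]; exact hpo t ht) e
    have h3 : max (-1) (min 1 (2 * s - 1)) = max (-1) (min 1 (2 * t - 1)) := congrFun h2 0
    rw [hps s hs, hps t ht] at h3
    linarith
  · intro x hx
    have hxu : x ∈ ⋃ (k : ℕ) (j : Topology.RelCWComplex.cell C k),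
        Topology.RelCWComplex.closedCell k j := by
      rw [Topology.CWComplex.union]; trivial
    simp only [mem_iUnion] at hxu
    obtain ⟨k, j, y, hy, e⟩ := hxu
    match k, j, y, hy, e with
    | 0, j, y, hy, e => exact (hx ⟨j, by rw [← e, hball0 y]⟩).elim
    | 1, j, y, hy, e =>
      have hy0 : |y 0| ≤ 1 := by
        simpa using (norm_le_pi_norm y 0).trans (mem_closedBall_zero_iff.1 hy)
      obtain ⟨hl, hr⟩ := abs_le.1 hy0
      have hpy : p ((y 0 + 1) / 2) = y := by
        funext k
        obtain rfl : k = 0 := Subsingleton.elim _ _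
        change max (-1) (min 1 (2 * ((y 0 + 1) / 2) - 1)) = y 0
        rw [mul_div_cancel₀ _ two_ne_zero, add_sub_cancel_right, min_eq_right hr, max_eq_right hl]
      rw [← hpy] at e
      rcases hl.eq_or_lt with h | h
      · exact (hx (e ▸ hsph j _ (by rw [hpn, ← h]; norm_num))).elim
      rcases hr.eq_or_lt with h' | h'
      · exact (hx (e ▸ hsph j _ (by rw [hpn, h']; norm_num))).elim
      · refine ⟨en j, (y 0 + 1) / 2, ⟨by linarith, by linarith⟩, ?_⟩
        simpa using e
    | k + 2, j, y, hy, e => exact ((hdim (k + 2) (by omega)).false j).elim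

/-! ### Merging arcs and essential vertices -/

namespace ArcDecomposition

variable {X : Type u} [TopologicalSpace X] {V : Set X} {ι : Type*}

/-- The arcs with the orientation of those with `β i = true` reversed. -/
def reorient (D : ArcDecomposition X V ι) (β : ι → Bool) : ArcDecomposition X V ι where
  arc i s := D.arc i (bif β i then 1 - s else s)
  continuous_arc i := by
    cases h : β i
    · simpa using D.continuous_arc i
    · exact (D.continuous_arc i).comp (continuous_const.sub continuous_id)
  finite_vertices := D.finite_vertices
  arc_zero_mem i := by cases h : β i <;> simp [D.arc_zero_mem, D.arc_one_mem]
  arc_one_mem i := by cases h : β i <;> simp [D.arc_zero_mem, D.arc_one_mem]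
  arc_notMem i s hs := D.arc_notMem i _ (by
    cases h : β i
    · exact hs
    · exact ⟨sub_pos.2 hs.2, by simpa using hs.1⟩)
  arc_injective i j s hs t ht e := by
    have mem : ∀ b : Bool, ∀ s ∈ Ioo (0 : ℝ) 1, (bif b then 1 - s else s) ∈ Ioo (0 : ℝ) 1 := by
      rintro (_ | _) s hs
      · exact hs
      · exact ⟨sub_pos.2 hs.2, by simpa using hs.1⟩
    obtain ⟨rfl, h⟩ := D.arc_injective i j _ (mem _ s hs) _ (mem _ t ht) e
    refine ⟨rfl, ?_⟩
    cases hb : β i <;> rw [hb] at h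
    · exact h
    · exact sub_right_injective h
  exists_arc x hx := by
    obtain ⟨i, s, hs, rfl⟩ := D.exists_arc x hx
    cases h : β i
    · exact ⟨i, s, hs, by simp [h]⟩
    · exact ⟨i, 1 - s, ⟨sub_pos.2 hs.2, by simpa using hs.1⟩, by simp [h]⟩

/-- If exactly one arc ends at the vertex `v` and exactly one other arc starts there, then these
two arcs can be joined to a single one, of which `v` is an inner point. -/
theorem exists_merge (D : ArcDecomposition X V ι) {v : X} {i j : ι} (hij : i ≠ j)
    (hi : D.arc i 1 = v) (hj : D.arc j 0 = v) (h0 : ∀ k, D.arc k 0 = v → k = j)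
    (h1 : ∀ k, D.arc k 1 = v → k = i) :
    Nonempty (ArcDecomposition X (V \ {v}) {k // k ≠ i}) := by
  classical
  let arc : {k // k ≠ i} → ℝ → X := fun k s =>
    if k.1 = j then (if s ≤ 1 / 2 then D.arc i (2 * s) else D.arc j (2 * s - 1)) else D.arc k s
  have hvV : v ∈ V := hj ▸ D.arc_zero_mem j
  have arc_low : ∀ s, s ≤ 1 / 2 → arc ⟨j, hij.symm⟩ s = D.arc i (2 * s) := fun s hs => by
    simp only [arc, if_true, if_pos hs]
  have arc_high : ∀ s, 1 / 2 < s → arc ⟨j, hij.symm⟩ s = D.arc j (2 * s - 1) := fun s hs => by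
    simp only [arc, if_true, if_neg (not_le.2 hs)]
  have arc_mid : arc ⟨j, hij.symm⟩ (1 / 2) = v := by
    rw [arc_low _ le_rfl, mul_one_div_cancel two_ne_zero, hi]
  have arc_ne : ∀ k : {k // k ≠ i}, k.1 ≠ j → arc k = D.arc k := fun k hk => by
    funext s; simp only [arc, if_neg hk]
  -- an inner point of a new arc is `v` or an inner point of an old arc
  have inner_cases : ∀ k : {k // k ≠ i}, ∀ s ∈ Ioo (0 : ℝ) 1,
      (k.1 = j ∧ s = 1 / 2 ∧ arc k s = v) ∨
      ∃ m, ∃ t ∈ Ioo (0 : ℝ) 1, arc k s = D.arc m t ∧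
        ((k.1 = j ∧ m = i ∧ t = 2 * s) ∨ (k.1 = j ∧ m = j ∧ t = 2 * s - 1) ∨
          (k.1 ≠ j ∧ m = k.1 ∧ t = s)) := by
    rintro ⟨k, hk⟩ s hs
    by_cases hkj : k = j
    · subst hkj
      rcases lt_trichotomy s (1 / 2) with h | h | h
      · exact .inr ⟨i, 2 * s, ⟨by linarith [hs.1], by linarith⟩, arc_low s h.le,
          .inl ⟨rfl, rfl, rfl⟩⟩
      · exact .inl ⟨rfl, h, h ▸ arc_mid⟩
      · exact .inr ⟨k, 2 * s - 1, ⟨by linarith, by linarith [hs.2]⟩, arc_high s h,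
          .inr (.inl ⟨rfl, rfl, rfl⟩)⟩
    · exact .inr ⟨k, s, hs, by rw [arc_ne _ hkj], .inr (.inr ⟨hkj, rfl, rfl⟩)⟩
  refine ⟨{
    arc := arc
    continuous_arc := ?_
    finite_vertices := D.finite_vertices.sdiff
    arc_zero_mem := ?_
    arc_one_mem := ?_
    arc_notMem := ?_
    arc_injective := ?_
    exists_arc := ?_ }⟩
  · rintro ⟨k, hk⟩
    by_cases hkj : k = j
    · subst hkj
      have : arc ⟨k, hk⟩ = fun s => if s ≤ 1 / 2 then D.arc i (2 * s) else D.arc k (2 * s - 1) := by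
        funext s; simp only [arc, if_true]
      rw [this]
      refine Continuous.if_le ((D.continuous_arc i).comp (by fun_prop))
        ((D.continuous_arc k).comp (by fun_prop)) continuous_id continuous_const ?_
      rintro s rfl
      norm_num [hi, hj]
    · rw [arc_ne _ hkj]; exact D.continuous_arc k
  · rintro ⟨k, hk⟩
    by_cases hkj : k = j
    · subst hkj
      rw [arc_low 0 (by norm_num), mul_zero]
      exact ⟨D.arc_zero_mem i, fun h => hij (h0 i h)⟩
    · rw [arc_ne _ hkj]
      exact ⟨D.arc_zero_mem k, fun h => hkj (h0 k h)⟩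
  · rintro ⟨k, hk⟩
    by_cases hkj : k = j
    · subst hkj
      rw [arc_high 1 (by norm_num)]
      norm_num
      exact ⟨D.arc_one_mem k, fun h => hk (h1 k h)⟩
    · rw [arc_ne _ hkj]
      exact ⟨D.arc_one_mem k, fun h => hk (h1 k h)⟩
  · rintro k s hs ⟨hV, hv⟩
    rcases inner_cases k s hs with ⟨-, -, e⟩ | ⟨m, t, ht, e, -⟩
    · exact hv e
    · exact D.arc_notMem m t ht (e ▸ hV)
  · rintro k k' s hs s' hs' h
    rcases inner_cases k s hs with ⟨hk, hs2, e⟩ | ⟨m, t, ht, e, hc⟩ <;>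
    rcases inner_cases k' s' hs' with ⟨hk', hs2', e'⟩ | ⟨m', t', ht', e', hc'⟩
    · exact ⟨Subtype.ext (hk.trans hk'.symm), hs2.trans hs2'.symm⟩
    · exact (D.arc_notMem m' t' ht' (e' ▸ h ▸ e.symm ▸ hvV)).elim
    · exact (D.arc_notMem m t ht (e ▸ h.symm ▸ e'.symm ▸ hvV)).elim
    · obtain ⟨hm, htt⟩ := D.arc_injective m m' t ht t' ht' (by rw [← e, ← e', h])
      have hki := k.2
      have hki' := k'.2
      have : k.1 = k'.1 ∧ s = s' := by
        rcases hc with ⟨a1, a2, a3⟩ | ⟨a1, a2, a3⟩ | ⟨a1, a2, a3⟩ <;>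
        rcases hc' with ⟨b1, b2, b3⟩ | ⟨b1, b2, b3⟩ | ⟨b1, b2, b3⟩ <;>
        first
        | exact ⟨by grind, by linarith⟩
        | (exfalso; grind)
      exact ⟨Subtype.ext this.1, this.2⟩
  · intro x hx
    by_cases hxv : x = v
    · exact ⟨⟨j, hij.symm⟩, 1 / 2, by norm_num, hxv ▸ arc_mid⟩
    obtain ⟨m, s, ⟨hs0, hs1⟩, rfl⟩ := D.exists_arc x fun h => hx ⟨h, hxv⟩
    by_cases hmi : m = i
    · subst hmi
      exact ⟨⟨j, hij.symm⟩, s / 2, ⟨by linarith, by linarith⟩, by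
        rw [arc_low _ (by linarith), mul_div_cancel₀ _ two_ne_zero]⟩
    by_cases hmj : m = j
    · subst hmj
      exact ⟨⟨m, hmi⟩, (s + 1) / 2, ⟨by linarith, by linarith⟩, by
        rw [arc_high _ (by linarith), mul_div_cancel₀ _ two_ne_zero, add_sub_cancel_right]⟩
    · exact ⟨⟨m, hmi⟩, s, ⟨hs0, hs1⟩, by rw [arc_ne _ hmj]⟩

/-- The half-edge `(i, b)` is the arc `i`, run from its initial point if `b = false` and from its
final point if `b = true`. -/
def half (D : ArcDecomposition X V ι) (h : ι × Bool) (s : ℝ) : X :=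
  D.arc h.1 (bif h.2 then 1 - s else s)

/-- The vertex `v` is *essential* if at least three half-edges start there. -/
def IsEssential (D : ArcDecomposition X V ι) (v : X) : Prop :=
  ∃ h₁ h₂ h₃ : ι × Bool, h₁ ≠ h₂ ∧ h₁ ≠ h₃ ∧ h₂ ≠ h₃ ∧
    D.half h₁ 0 = v ∧ D.half h₂ 0 = v ∧ D.half h₃ 0 = v

theorem half_zero_mem (D : ArcDecomposition X V ι) (h : ι × Bool) : D.half h 0 ∈ V := by
  obtain ⟨i, _ | _⟩ := h <;> simp [half, D.arc_zero_mem, D.arc_one_mem]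

/-- A non-essential vertex at which half-edges of two different arcs start can be removed. -/
theorem exists_merge_of_not_isEssential (D : ArcDecomposition X V ι) {v : X}
    (hv : ¬ D.IsEssential v) {i j : ι} (hij : i ≠ j) {b c : Bool} (hi : D.half (i, b) 0 = v)
    (hj : D.half (j, c) 0 = v) : Nonempty (ArcDecomposition X (V \ {v}) {k // k ≠ i}) := by
  classical
  have only : ∀ h, D.half h 0 = v → h = (i, b) ∨ h = (j, c) := by
    intro h hh
    by_contra hne
    rw [not_or] at hne
    exact hv ⟨h, (i, b), (j, c), hne.1, hne.2, by simp [hij], hh, hi, hj⟩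
  let β : ι → Bool := fun k => if k = i then !b else if k = j then c else false
  have hβi : β i = !b := if_pos rfl
  have hβj : β j = c := by simp [β, hij.symm]
  refine (D.reorient β).exists_merge (v := v) hij ?_ ?_ ?_ ?_
  · rw [← hi]
    simp only [reorient, half, hβi]
    cases b <;> simp
  · rw [← hj]
    simp only [reorient, half, hβj]
  · intro k hk
    rcases only (k, β k) hk with h | h
    · obtain ⟨rfl, h⟩ := Prod.mk.inj h
      rw [hβi] at h
      cases b <;> simp at h
    · exact (Prod.mk.inj h).1
  · intro k hk
    have hk' : D.half (k, !β k) 0 = v := by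
      rw [← hk]
      simp only [reorient, half]
      cases β k <;> simp
    rcases only (k, !β k) hk' with h | h
    · exact (Prod.mk.inj h).1
    · obtain ⟨rfl, h⟩ := Prod.mk.inj h
      rw [hβj] at h
      cases c <;> simp at h

/-- If the arc `i` shares no end point with another arc, then it fills the connected space `X`. -/
theorem arc_image_eq_univ (D : ArcDecomposition X V ι) [Finite ι] [T2Space X] [ConnectedSpace X]
    (i : ι) (hi : ∀ k ≠ i, ∀ b c, D.half (k, b) 0 ≠ D.half (i, c) 0) :
    D.arc i '' Icc 0 1 = univ := by
  refine (D.isClopen_subgraph fun k => ?_).eq_univ ⟨_, mem_image_of_mem _ ⟨le_rfl, zero_le_one⟩⟩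
  by_cases hk : k = i
  · subst hk
    exact .inl fun s hs => mem_image_of_mem _ hs
  · right
    have hend : ∀ b, D.half (k, b) 0 ∉ D.arc i '' Icc 0 1 := by
      rintro b ⟨t, ht, e⟩
      rcases (D.arc_mem_iff i ht).1 (e ▸ D.half_zero_mem _) with rfl | rfl
      · exact hi k hk b false (by simpa [half] using e.symm)
      · exact hi k hk b true (by simpa [half] using e.symm)
    intro s hs hmem
    rcases mem_Icc_zero_one_cases hs with rfl | rfl | hs'
    · exact hend false (by simpa [half] using hmem)
    · exact hend true (by simpa [half] using hmem)
    · obtain ⟨t, ht, e⟩ := hmem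
      rcases mem_Icc_zero_one_cases ht with rfl | rfl | ht'
      · exact D.arc_notMem k s hs' (e ▸ D.arc_zero_mem i)
      · exact D.arc_notMem k s hs' (e ▸ D.arc_one_mem i)
      · exact hk (D.arc_injective i k t ht' s hs' e).1.symm

/-- A space that is a single arc with distinct end points is an interval. -/
theorem nonempty_homeomorph_unitInterval (D : ArcDecomposition X V ι) [T2Space X] {i : ι}
    (hi : D.arc i '' Icc 0 1 = univ) (hne : D.arc i 0 ≠ D.arc i 1) :
    Nonempty (X ≃ₜ unitInterval) := by
  let f : I → X := fun s => D.arc i s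
  have hf : Continuous f := (D.continuous_arc i).comp continuous_subtype_val
  have hbij : Function.Bijective f := by
    constructor
    · rintro ⟨s, hs⟩ ⟨t, ht⟩ (e : D.arc i s = D.arc i t)
      refine Subtype.ext ?_
      change s = t
      rcases mem_Icc_zero_one_cases hs with rfl | rfl | hs' <;>
      rcases mem_Icc_zero_one_cases ht with rfl | rfl | ht'
      · rfl
      · exact (hne e).elim
      · exact (D.arc_notMem i t ht' (e ▸ D.arc_zero_mem i)).elim
      · exact (hne e.symm).elim
      · rfl
      · exact (D.arc_notMem i t ht' (e ▸ D.arc_one_mem i)).elim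
      · exact (D.arc_notMem i s hs' (e ▸ D.arc_zero_mem i)).elim
      · exact (D.arc_notMem i s hs' (e ▸ D.arc_one_mem i)).elim
      · exact (D.arc_injective i i s hs' t ht' e).2
    · intro x
      obtain ⟨s, hs, e⟩ := hi ▸ mem_univ x
      exact ⟨⟨s, hs⟩, e⟩
  exact ⟨(Continuous.homeoOfEquivCompactToT2 (f := Equiv.ofBijective f hbij) hf).symm⟩

/-- A space that is a single arc whose end points coincide is a circle. -/
theorem nonempty_homeomorph_circle (D : ArcDecomposition X V ι) [Finite ι] [T2Space X] {i : ι}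
    (hi : D.arc i '' Icc 0 1 = univ) (heq : D.arc i 0 = D.arc i 1) : Nonempty (X ≃ₜ Circle) := by
  have := D.compactSpace
  have h10 : ((1 : ℝ) : AddCircle (1 : ℝ)) = 0 := AddCircle.coe_period 1
  obtain ⟨f, hf, hfV⟩ := D.exists_glue_map (fun _ s => (s : AddCircle (1 : ℝ)))
    (fun _ => AddCircle.continuous_mk' 1) (fun _ => 0) (fun _ => by simp) (fun _ => h10)
  have surj : ∀ x, ∃ s ∈ Ico (0 : ℝ) 1, D.arc i s = x := by
    intro x
    obtain ⟨s, hs, e⟩ := hi ▸ mem_univ x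
    rcases hs.2.eq_or_lt with rfl | h
    · exact ⟨0, by simp, heq.trans e⟩
    · exact ⟨s, ⟨hs.1, h⟩, e⟩
  have hbij : Function.Bijective f := by
    constructor
    · intro x y h
      obtain ⟨s, hs, rfl⟩ := surj x
      obtain ⟨t, ht, rfl⟩ := surj y
      rw [hf i s (Ico_subset_Icc_self hs), hf i t (Ico_subset_Icc_self ht)] at h
      have : Fact ((0 : ℝ) < 1) := ⟨one_pos⟩
      rw [AddCircle.coe_eq_coe_iff_of_mem_Ico (a := 0) (by simpa using hs) (by simpa using ht)] at h
      rw [h]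
    · intro z
      have : Fact ((0 : ℝ) < 1) := ⟨one_pos⟩
      obtain ⟨s, hs, e⟩ := (AddCircle.coe_image_Ico_eq (1 : ℝ) 0).symm ▸ mem_univ z
      rw [zero_add] at hs
      exact ⟨D.arc i s, (hf i s (Ico_subset_Icc_self hs)).trans e⟩
  exact ⟨(Continuous.homeoOfEquivCompactToT2 (f := Equiv.ofBijective f hbij) f.continuous).trans
    (AddCircle.homeomorphCircle one_ne_zero)⟩

/-- A connected finite graph other than a point, an interval or a circle has an essential vertex in
a suitable decomposition: remove non-essential vertices between two arcs as long as there are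
any; if no essential vertex is left, the remaining arcs have no common end points, so that there
is only one. -/
theorem exists_isEssential {X : Type u} [TopologicalSpace X] [T2Space X] [ConnectedSpace X]
    [Nontrivial X] (hcircle : ¬ Nonempty (X ≃ₜ Circle))
    (hinterval : ¬ Nonempty (X ≃ₜ unitInterval)) {V : Set X} {ι : Type} [Finite ι]
    (D : ArcDecomposition X V ι) :
    ∃ (W : Set X) (κ : Type) (_ : Finite κ) (E : ArcDecomposition X W κ) (v : X),
      E.IsEssential v := by
  induction hn : V.ncard using Nat.strong_induction_on generalizing V ι with
  | _ n ih =>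
  by_cases hess : ∃ v, D.IsEssential v
  · obtain ⟨v, hv⟩ := hess
    exact ⟨V, ι, inferInstance, D, v, hv⟩
  rw [not_exists] at hess
  by_cases hshare : ∃ i j b c, i ≠ j ∧ D.half (i, b) 0 = D.half (j, c) 0
  · obtain ⟨i, j, b, c, hij, e⟩ := hshare
    obtain ⟨D'⟩ := D.exists_merge_of_not_isEssential (hess _) hij e rfl
    refine ih _ ?_ D' rfl
    rw [← hn]
    exact ncard_sdiff_singleton_lt_of_mem (D.half_zero_mem _) D.finite_vertices
  · exfalso
    rcases isEmpty_or_nonempty ι with hι | ⟨⟨i⟩⟩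
    · obtain ⟨x, y, hxy⟩ := exists_pair_ne X
      have hx : IsClopen ({x} : Set X) := D.isClopen_subgraph fun i => (hι.false i).elim
      have : y ∈ ({x} : Set X) := hx.eq_univ ⟨x, rfl⟩ ▸ mem_univ y
      exact hxy this.symm
    · have hi := D.arc_image_eq_univ i fun k hk b c e => hshare ⟨k, i, b, c, hk, e⟩
      by_cases heq : D.arc i 0 = D.arc i 1
      · exact hcircle (D.nonempty_homeomorph_circle hi heq)
      · exact hinterval (D.nonempty_homeomorph_unitInterval hi heq)

end ArcDecomposition

/-! ### Stars -/

section Star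

variable {H : Type*} [DecidableEq H]

/-- The star with legs of length one indexed by `H`: the union of the unit segments on the
coordinate half-axes of `H → ℝ`. -/
def starGraph (H : Type*) [DecidableEq H] : Set (H → ℝ) :=
  ⋃ h : H, (fun s : ℝ => Pi.single h s) '' Icc 0 1

theorem mem_starGraph {x : H → ℝ} :
    x ∈ starGraph H ↔ ∃ h, ∃ s ∈ Icc (0 : ℝ) 1, Pi.single h s = x := by
  simp [starGraph]

theorem single_mem_starGraph (h : H) {s : ℝ} (hs : s ∈ Icc (0 : ℝ) 1) :
    (Pi.single h s : H → ℝ) ∈ starGraph H :=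
  mem_starGraph.2 ⟨h, s, hs, rfl⟩

theorem zero_mem_starGraph [Nonempty H] : (0 : H → ℝ) ∈ starGraph H :=
  mem_starGraph.2 ⟨Classical.arbitrary H, 0, by simp, by simp⟩

theorem single_eq_single {h k : H} {s t : ℝ} (e : (Pi.single h s : H → ℝ) = Pi.single k t) :
    s = t ∧ (h = k ∨ s = 0) := by
  by_cases hk : h = k
  · subst hk
    exact ⟨Pi.single_injective h e, .inl rfl⟩
  · have h1 := congrFun e h
    have h2 := congrFun e k
    simp only [Pi.single_eq_same, Pi.single_eq_of_ne hk, Pi.single_eq_of_ne (Ne.symm hk)] at h1 h2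
    exact ⟨h1.trans h2, .inr h1⟩

theorem isCompact_starGraph [Finite H] : IsCompact (starGraph H) :=
  isCompact_iUnion fun h => isCompact_Icc.image (continuous_single (A := fun _ : H => ℝ) h)

theorem starConvex_starGraph : StarConvex ℝ 0 (starGraph H) := by
  intro y hy a b ha hb hab
  obtain ⟨h, s, hs, rfl⟩ := mem_starGraph.1 hy
  refine mem_starGraph.2 ⟨h, b * s, ⟨mul_nonneg hb hs.1, ?_⟩, ?_⟩
  · nlinarith [hs.1, hs.2]
  · rw [smul_zero, zero_add, ← Pi.single_smul, smul_eq_mul]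

/-- The configurations of two distinct points of the star. -/
def starConf (H : Type*) [DecidableEq H] : Set ((H → ℝ) × (H → ℝ)) :=
  {z | z.1 ∈ starGraph H ∧ z.2 ∈ starGraph H ∧ z.1 ≠ z.2}

theorem joinedIn_starConf_swap {x y x' y' : H → ℝ} (h : JoinedIn (starConf H) (x, y) (x', y')) :
    JoinedIn (starConf H) (y, x) (y', x') := by
  obtain ⟨γ, hγ⟩ := h
  exact ⟨γ.map continuous_swap, fun t => ⟨(hγ t).2.1, (hγ t).1, (hγ t).2.2.symm⟩⟩

/-- One point moves along a leg while the other one rests. -/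
theorem joinedIn_starConf_move {h : H} {s t : ℝ} {y : H → ℝ} (hs : s ∈ Icc (0 : ℝ) 1)
    (ht : t ∈ Icc (0 : ℝ) 1) (hy : y ∈ starGraph H) (hne : ∀ r ∈ uIcc s t, Pi.single h r ≠ y) :
    JoinedIn (starConf H) (Pi.single h s, y) (Pi.single h t, y) := by
  have hp : IsPathConnected ((fun r : ℝ => ((Pi.single h r : H → ℝ), y)) '' uIcc s t) :=
    ((convex_uIcc s t).isPathConnected nonempty_uIcc).image
      ((continuous_single (A := fun _ : H => ℝ) h).prodMk continuous_const)
  refine (hp.joinedIn _ (mem_image_of_mem _ left_mem_uIcc) _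
    (mem_image_of_mem _ right_mem_uIcc)).mono ?_
  rintro _ ⟨r, hr, rfl⟩
  exact ⟨single_mem_starGraph h (uIcc_subset_Icc hs ht hr), hy, hne r hr⟩

theorem joinedIn_starConf_retract {h k : H} {s t : ℝ} (hs : s ∈ Icc (0 : ℝ) 1)
    (ht : t ∈ Icc (0 : ℝ) 1) (ht0 : t ≠ 0) (hst : h = k → s < t) :
    JoinedIn (starConf H) (Pi.single h s, Pi.single k t) (0, Pi.single k t) := by
  rw [← Pi.single_zero h]
  refine joinedIn_starConf_move hs (by simp) (single_mem_starGraph k ht) fun r hr e => ?_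
  rw [uIcc_of_ge hs.1] at hr
  obtain ⟨rfl, hk | h0⟩ := single_eq_single e
  · exact absurd (hst hk) (not_lt.2 hr.2)
  · exact ht0 h0

/-- In a star with at least three legs, any configuration of two distinct points can be moved to
any other: a point that is not behind the other one retracts to the centre, and two points
exchange their legs with the help of a third one. -/
theorem joinedIn_starConf (h3 : ∀ k l : H, ∃ m, m ≠ k ∧ m ≠ l) {z w : (H → ℝ) × (H → ℝ)}
    (hz : z ∈ starConf H) (hw : w ∈ starConf H) : JoinedIn (starConf H) z w := by
  have one_mem : (1 : ℝ) ∈ Icc (0 : ℝ) 1 := by simp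
  have retract : ∀ h k : H, h ≠ k → ∀ s ∈ Icc (0 : ℝ) 1, ∀ t ∈ Icc (0 : ℝ) 1, t ≠ 0 →
      JoinedIn (starConf H) (Pi.single h s, Pi.single k t) (0, Pi.single k t) :=
    fun h k hk s hs t ht ht0 => joinedIn_starConf_retract hs ht ht0 fun e => (hk e).elim
  -- a configuration with one point at the centre and the other one at the end of a leg
  have centre : ∀ z ∈ starConf H, ∃ k : H, JoinedIn (starConf H) z (0, Pi.single k 1) := by
    have from_zero : ∀ k : H, ∀ t ∈ Icc (0 : ℝ) 1, t ≠ 0 →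
        JoinedIn (starConf H) (0, Pi.single k t) (0, Pi.single k 1) := by
      intro k t ht ht0
      have : Nonempty H := ⟨k⟩
      refine joinedIn_starConf_swap
        (joinedIn_starConf_move ht one_mem zero_mem_starGraph fun r hr e => ?_)
      rw [uIcc_of_le ht.2] at hr
      rw [← Pi.single_zero k] at e
      have := (single_eq_single e).1
      exact ht0 (le_antisymm (this ▸ hr.1) ht.1)
    have from_right : ∀ h : H, ∀ s ∈ Icc (0 : ℝ) 1, s ≠ 0 →
        ∃ k : H, JoinedIn (starConf H) (Pi.single h s, 0) (0, Pi.single k 1) := by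
      intro h s hs hs0
      obtain ⟨k, hk, -⟩ := h3 h h
      exact ⟨k, (joinedIn_starConf_swap (retract k h hk 1 one_mem s hs hs0)).symm.trans
        (retract h k hk.symm s hs 1 one_mem one_ne_zero)⟩
    rintro ⟨x, y⟩ ⟨hx, hy, hxy⟩
    obtain ⟨h, s, hs, rfl⟩ := mem_starGraph.1 hx
    obtain ⟨k, t, ht, rfl⟩ := mem_starGraph.1 hy
    by_cases ht0 : t = 0
    · subst ht0
      have hs0 : s ≠ 0 := by rintro rfl; simp at hxy
      simpa using from_right h s hs hs0
    by_cases hs0 : s = 0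
    · subst hs0
      exact ⟨k, by simpa using from_zero k t ht ht0⟩
    by_cases hst : h = k → s < t
    · exact ⟨k, (joinedIn_starConf_retract hs ht ht0 hst).trans (from_zero k t ht ht0)⟩
    · rw [Classical.not_imp, not_lt] at hst
      obtain ⟨rfl, hts⟩ := hst
      have hlt : t < s := hts.lt_of_ne fun e => hxy (by rw [e])
      obtain ⟨k, hk⟩ := from_right h s hs hs0
      exact ⟨k, (joinedIn_starConf_swap
        (joinedIn_starConf_retract ht hs hs0 fun _ => hlt)).trans hk⟩
  have exchange : ∀ k l : H, JoinedIn (starConf H) (0, Pi.single k 1) (0, Pi.single l 1) := by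
    intro k l
    obtain ⟨m, hmk, hml⟩ := h3 k l
    have half : ∀ k : H, m ≠ k →
        JoinedIn (starConf H) (0, Pi.single k 1) (Pi.single m 1, 0) := fun k hk =>
      (retract m k hk 1 one_mem 1 one_mem one_ne_zero).symm.trans
        (joinedIn_starConf_swap (retract k m hk.symm 1 one_mem 1 one_mem one_ne_zero))
    exact (half k hmk).trans (half l hml).symm
  obtain ⟨k, hk⟩ := centre z hz
  obtain ⟨l, hl⟩ := centre w hw
  exact hk.trans ((exchange k l).trans hl.symm)

end Star

namespace ArcDecomposition

variable {X : Type u} [TopologicalSpace X] {V : Set X} {ι : Type*}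

theorem continuous_half (D : ArcDecomposition X V ι) (h : ι × Bool) : Continuous (D.half h) := by
  obtain ⟨i, _ | _⟩ := h
  · exact D.continuous_arc i
  · exact (D.continuous_arc i).comp (continuous_const.sub continuous_id)

/-- The first halves of two half-edges are disjoint except for their initial points. -/
theorem half_injective (D : ArcDecomposition X V ι) {h k : ι × Bool} {s t : ℝ}
    (hs : s ∈ Ioo (0 : ℝ) (1 / 2)) (ht : t ∈ Ico (0 : ℝ) (1 / 2)) (e : D.half h s = D.half k t) :
    h = k ∧ s = t := by
  obtain ⟨i, b⟩ := h
  obtain ⟨j, c⟩ := k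
  have mem : ∀ b : Bool, ∀ s ∈ Ioo (0 : ℝ) (1 / 2), (bif b then 1 - s else s) ∈ Ioo (0 : ℝ) 1 := by
    rintro (_ | _) s ⟨h0, h1⟩ <;> constructor <;> simp <;> linarith
  rcases ht.1.eq_or_lt with rfl | h0
  · exact (D.arc_notMem i _ (mem b s hs) (by
      rw [show D.arc i (bif b then 1 - s else s) = D.half (j, c) 0 from e]
      exact D.half_zero_mem _)).elim
  · obtain ⟨rfl, h⟩ := D.arc_injective i j _ (mem b s hs) _ (mem c t ⟨h0, ht.2⟩) e
    have hs2 := hs.2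
    have ht2 := ht.2
    cases b <;> cases c <;> simp only [cond_true, cond_false] at h
    · exact ⟨rfl, h⟩
    · linarith
    · linarith
    · exact ⟨rfl, by linarith⟩

theorem mem_or_exists_half (D : ArcDecomposition X V ι) (x : X) :
    x ∈ V ∨ ∃ h, ∃ s ∈ Ioc (0 : ℝ) (1 / 2), D.half h s = x := by
  rcases D.mem_or_exists_arc x with hV | ⟨i, s, hs, rfl⟩
  · exact .inl hV
  · right
    rcases le_total s (1 / 2) with h | h
    · exact ⟨(i, false), s, ⟨hs.1, h⟩, rfl⟩
    · exact ⟨(i, true), 1 - s, ⟨sub_pos.2 hs.2, by linarith⟩, by simp [half]⟩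

/-- The closed star of an essential vertex, made of the first thirds of the half-edges that start
there, is a passing place. -/
theorem IsEssential.exists_isPassingPlace [T2Space X] [Finite ι] {D : ArcDecomposition X V ι}
    {v : X} (hv : D.IsEssential v) : ∃ U, IsPassingPlace U v := by
  classical
  let H := {h : ι × Bool // D.half h 0 = v}
  obtain ⟨h₁, h₂, h₃, h12, h13, h23, e₁, e₂, e₃⟩ := hv
  have h3 : ∀ k l : H, ∃ m, m ≠ k ∧ m ≠ l := by
    intro k l
    by_contra! hcon
    have key : ∀ h, D.half h 0 = v → h = k.1 ∨ h = l.1 := fun h hh =>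
      or_iff_not_imp_left.2 fun hk =>
        congrArg Subtype.val (hcon ⟨h, hh⟩ fun e => hk (congrArg Subtype.val e))
    have c₁ := key h₁ e₁
    have c₂ := key h₂ e₂
    have c₃ := key h₃ e₃
    grind
  have : Nonempty H := ⟨⟨h₁, e₁⟩⟩
  let f : H → ℝ → X := fun h s => D.half h.1 (s / 3)
  have hf : ∀ h, Continuous (f h) := fun h => (D.continuous_half _).comp (by fun_prop)
  have hf0 : ∀ h, f h 0 = v := fun h => by simpa [f] using h.2
  have hfinj : ∀ h k, ∀ s ∈ Icc (0 : ℝ) 1, ∀ t ∈ Icc (0 : ℝ) 1, f h s = f k t →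
      (Pi.single h s : H → ℝ) = Pi.single k t := by
    intro h k s hs t ht e
    have inj : ∀ h k : H, ∀ s ∈ Ioc (0 : ℝ) 1, ∀ t ∈ Icc (0 : ℝ) 1, f h s = f k t →
        (Pi.single h s : H → ℝ) = Pi.single k t := by
      intro h k s hs t ht e
      obtain ⟨ehk, est⟩ := D.half_injective (s := s / 3) (t := t / 3)
        ⟨by linarith [hs.1], by linarith [hs.2]⟩ ⟨by linarith [ht.1], by linarith [ht.2]⟩ e
      rw [Subtype.ext ehk, show s = t by linarith]
    rcases hs.1.eq_or_lt with rfl | hs0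
    · rcases ht.1.eq_or_lt with rfl | ht0
      · simp
      · exact (inj k h t ⟨ht0, ht.2⟩ 0 hs e.symm).symm
    · exact inj h k s ⟨hs0, hs.2⟩ t ht e
  -- the parametrization of the closed star of `v` by the model star
  choose leg len hlen hsingle using fun x : starGraph H => mem_starGraph.1 x.2
  let ρ : starGraph H → X := fun x => f (leg x) (len x)
  have hρ : ∀ h, ∀ s (hs : s ∈ Icc (0 : ℝ) 1),
      ρ ⟨Pi.single h s, single_mem_starGraph h hs⟩ = f h s := by
    intro h s hs
    obtain ⟨el, eh | eh⟩ := single_eq_single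
      (hsingle ⟨Pi.single h s, single_mem_starGraph h hs⟩)
    · simp only [ρ, el, eh]
    · change f _ (len _) = f h s
      rw [eh, hf0, ← hf0 h, el.symm.trans eh]
  have hρc : Continuous ρ := by
    refine continuous_iff_isClosed.2 fun C hC => ?_
    have e : ρ ⁻¹' C = Subtype.val ⁻¹' ⋃ h : H, (fun s : ℝ => (Pi.single h s : H → ℝ)) ''
        (Icc 0 1 ∩ f h ⁻¹' C) := by
      ext x
      simp only [mem_preimage, mem_iUnion]
      constructor
      · intro hx
        exact ⟨leg x, len x, ⟨hlen x, hx⟩, hsingle x⟩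
      · rintro ⟨h, s, ⟨hs, hsC⟩, e⟩
        obtain rfl : x = ⟨Pi.single h s, single_mem_starGraph h hs⟩ := Subtype.ext e.symm
        rwa [hρ h s hs]
    rw [e]
    exact (isClosed_iUnion_of_finite fun h => ((isCompact_Icc.inter_right
      (hC.preimage (hf h))).image
        (continuous_single (A := fun _ : H => ℝ) h)).isClosed).preimage continuous_subtype_val
  have hρi : Function.Injective ρ := fun x y e => Subtype.ext (by
    rw [← hsingle x, ← hsingle y]
    exact hfinj _ _ _ (hlen x) _ (hlen y) e)
  have : CompactSpace (starGraph H) := isCompact_iff_compactSpace.1 isCompact_starGraph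
  have hemb : Topology.IsEmbedding ρ := (hρc.isClosedEmbedding hρi).isEmbedding
  have hrange : ∀ h : H, ∀ s ∈ Icc (0 : ℝ) 1, f h s ∈ range ρ := fun h s hs =>
    ⟨_, hρ h s hs⟩
  refine ⟨range ρ, ?_, ?_, ?_, ?_⟩
  · have : ContractibleSpace (starGraph H) :=
      starConvex_starGraph.contractibleSpace ⟨0, zero_mem_starGraph⟩
    rw [← image_univ, hemb.isSimplyConnected_image]
    have : SimplyConnectedSpace (univ : Set (starGraph H)) :=
      (Homeomorph.Set.univ _).toHomotopyEquiv.simplyConnectedSpace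
    exact this
  · let Z : Set X := (V \ {v}) ∪
      ((⋃ h : {h : ι × Bool // D.half h 0 ≠ v}, D.half h.1 '' Icc 0 (1 / 2)) ∪
        ⋃ h : ι × Bool, D.half h '' Icc (1 / 3) (1 / 2))
    have hZ : IsClosed Z := (D.isClosed_subset_vertices sdiff_subset).union
      ((isClosed_iUnion_of_finite fun h =>
        (isCompact_Icc.image (D.continuous_half _)).isClosed).union
        (isClosed_iUnion_of_finite fun h =>
          (isCompact_Icc.image (D.continuous_half _)).isClosed))
    have hvV : v ∈ V := e₁ ▸ D.half_zero_mem h₁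
    have hinner : ∀ h, ∀ s ∈ Ioc (0 : ℝ) (1 / 2), D.half h s ≠ v := by
      rintro ⟨i, _ | _⟩ s ⟨h0, h1⟩ e
      · exact D.arc_notMem i s ⟨h0, by linarith⟩ (by rw [show D.arc i s = v from e]; exact hvV)
      · exact D.arc_notMem i (1 - s) ⟨by linarith, by linarith⟩
          (by rw [show D.arc i (1 - s) = v from e]; exact hvV)
    refine mem_interior.2 ⟨Zᶜ, fun x hx => ?_, hZ.isOpen_compl, ?_⟩
    · simp only [Z, mem_compl_iff, mem_union, not_or, mem_iUnion, not_exists] at hx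
      obtain ⟨hxV, hx0, hx1⟩ := hx
      rcases D.mem_or_exists_half x with hV | ⟨h, s, hs, rfl⟩
      · have : x = v := by
          by_contra hne
          exact hxV ⟨hV, hne⟩
        have h := hrange ⟨h₁, e₁⟩ 0 (by simp)
        rw [hf0] at h
        exact this.symm ▸ h
      · have hh : D.half h 0 = v := by
          by_contra hne
          exact hx0 ⟨h, hne⟩ ⟨s, ⟨hs.1.le, hs.2⟩, rfl⟩
        have hs3 : s < 1 / 3 := by
          by_contra hge
          exact hx1 h ⟨s, ⟨not_lt.1 hge, hs.2⟩, rfl⟩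
        have := hrange ⟨h, hh⟩ (s * 3) ⟨by linarith [hs.1], by linarith⟩
        simpa [f] using this
    · simp only [Z, mem_compl_iff, mem_union, not_or, mem_iUnion, not_exists]
      refine ⟨fun h => h.2 rfl, ?_, ?_⟩
      · rintro ⟨h, hh⟩ ⟨s, hs, e⟩
        rcases hs.1.eq_or_lt with rfl | h0
        · exact hh e
        · exact hinner h s ⟨h0, hs.2⟩ e
      · rintro h ⟨s, hs, e⟩
        exact hinner h s ⟨by linarith [hs.1], hs.2⟩ e
  · refine ⟨_, hrange ⟨h₁, e₁⟩ 0 (by simp), _, hrange ⟨h₁, e₁⟩ 1 (by simp), fun e => ?_⟩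
    have := (single_eq_single (hfinj _ _ 0 (by simp) 1 (by simp) e)).1
    exact zero_ne_one this
  · rintro _ ⟨p, rfl⟩ _ ⟨q, rfl⟩ _ ⟨p', rfl⟩ _ ⟨q', rfl⟩ hne hne'
    obtain ⟨γ, hγ⟩ := joinedIn_starConf h3
      (z := (p.1, q.1)) (w := (p'.1, q'.1))
      ⟨p.2, q.2, fun e => hne (congrArg ρ (Subtype.ext e))⟩
      ⟨p'.2, q'.2, fun e => hne' (congrArg ρ (Subtype.ext e))⟩
    refine ⟨⟨⟨fun t => (ρ ⟨(γ t).1, (hγ t).1⟩, ρ ⟨(γ t).2, (hγ t).2.1⟩), ?_⟩, ?_, ?_⟩, fun t => ?_⟩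
    · exact (hρc.comp ((continuous_fst.comp γ.continuous).subtype_mk _)).prodMk
        (hρc.comp ((continuous_snd.comp γ.continuous).subtype_mk _))
    · simp
    · simp
    · exact ⟨mem_range_self _, mem_range_self _, fun e =>
        (hγ t).2.2 (congrArg Subtype.val (hρi e))⟩

end ArcDecomposition

/-! ### The action of a free involution on the arcs -/

namespace ArcDecomposition

variable {X : Type u} [TopologicalSpace X] {V : Set X} {ι : Type*}

/-- The parameter of a point of an open arc is a continuous function of the point. -/
theorem exists_param (D : ArcDecomposition X V ι) [Finite ι] [T2Space X] (i : ι) :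
    ∃ p : X → ℝ, ContinuousOn p (D.arc i '' Ioo 0 1) ∧
      ∀ s ∈ Ioo (0 : ℝ) 1, p (D.arc i s) = s := by
  classical
  -- `s = (s² (1 - s)) / (s (1 - s))`, where both polynomials vanish at the end points of the arc
  obtain ⟨w, hw, -⟩ := D.exists_glue_map (fun k s => if k = i then s * s * (1 - s) else 0)
    (fun k => by split_ifs <;> fun_prop) (fun _ => 0) (fun k => by simp) (fun k => by simp)
  obtain ⟨u, hu, -⟩ := D.exists_glue_map (fun k s => if k = i then s * (1 - s) else 0)
    (fun k => by split_ifs <;> fun_prop) (fun _ => 0) (fun k => by simp) (fun k => by simp)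
  have hu' : ∀ s ∈ Ioo (0 : ℝ) 1, u (D.arc i s) = s * (1 - s) := fun s hs => by
    rw [hu i s (Ioo_subset_Icc_self hs), if_pos rfl]
  have hw' : ∀ s ∈ Ioo (0 : ℝ) 1, w (D.arc i s) = s * s * (1 - s) := fun s hs => by
    rw [hw i s (Ioo_subset_Icc_self hs), if_pos rfl]
  have hpos : ∀ s ∈ Ioo (0 : ℝ) 1, s * (1 - s) ≠ 0 := fun s hs =>
    (mul_pos hs.1 (sub_pos.2 hs.2)).ne'
  refine ⟨fun x => w x / u x, w.continuous.continuousOn.div u.continuous.continuousOn ?_, ?_⟩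
  · rintro _ ⟨s, hs, rfl⟩
    rw [hu' s hs]
    exact hpos s hs
  · intro s hs
    change w (D.arc i s) / u (D.arc i s) = s
    rw [hw' s hs, hu' s hs, mul_assoc, mul_div_assoc, div_self (hpos s hs), mul_one]

/-- A continuous map that preserves the complement of the vertices maps each open arc into an
open arc. -/
theorem exists_mapsTo_arc (D : ArcDecomposition X V ι) [Finite ι] [T2Space X] {τ : X → X}
    (hτ : Continuous τ) (hV : ∀ x ∉ V, τ x ∉ V) (i : ι) :
    ∃ j, ∀ s ∈ Ioo (0 : ℝ) 1, ∃ t ∈ Ioo (0 : ℝ) 1, D.arc j t = τ (D.arc i s) := by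
  have hhalf : (1 / 2 : ℝ) ∈ Ioo (0 : ℝ) 1 := by norm_num
  obtain ⟨j, t, ht, e⟩ := D.exists_arc _ (hV _ (D.arc_notMem i _ hhalf))
  have hpre : IsPreconnected ((fun s => τ (D.arc i s)) '' Ioo 0 1) :=
    isPreconnected_Ioo.image _ (hτ.comp (D.continuous_arc i)).continuousOn
  -- the image is connected and covered by the open arc `j` and the union of the other open arcs
  have hopen : IsOpen (⋃ k : {k // k ≠ j}, D.arc k.1 '' Ioo 0 1) :=
    isOpen_iUnion fun k => D.isOpen_arc k.1
  have hsub := hpre.subset_left_of_subset_union (D.isOpen_arc j) hopen ?_ ?_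
    ⟨_, mem_image_of_mem _ hhalf, t, ht, e⟩
  · refine ⟨j, fun s hs => ?_⟩
    obtain ⟨t, ht, e⟩ := hsub (mem_image_of_mem _ hs)
    exact ⟨t, ht, e⟩
  · rw [disjoint_left]
    rintro _ ⟨s, hs, rfl⟩ h
    obtain ⟨⟨k, hk⟩, t, ht, e⟩ := mem_iUnion.1 h
    exact hk (D.arc_injective k j t ht s hs e).1
  · rintro _ ⟨s, hs, rfl⟩
    obtain ⟨k, r, hr, er⟩ := D.exists_arc _ (hV _ (D.arc_notMem i s hs))
    by_cases hk : k = j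
    · subst hk
      exact .inl ⟨r, hr, er⟩
    · exact .inr (mem_iUnion.2 ⟨⟨k, hk⟩, r, hr, er⟩)

/-- A free involution does not map an open arc into itself: it would induce an involution of an
open interval, which has a fixed point by the intermediate value theorem. -/
theorem not_mapsTo_arc_self (D : ArcDecomposition X V ι) [Finite ι] [T2Space X] {τ : C(X, X)}
    (hτ : IsFreeInvolution τ) (i : ι) :
    ¬ ∀ s ∈ Ioo (0 : ℝ) 1, ∃ t ∈ Ioo (0 : ℝ) 1, D.arc i t = τ (D.arc i s) := by
  intro h
  obtain ⟨p, hp, hps⟩ := D.exists_param i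
  let φ : ℝ → ℝ := fun s => p (τ (D.arc i s))
  have hφ : ∀ s ∈ Ioo (0 : ℝ) 1, φ s ∈ Ioo (0 : ℝ) 1 ∧ D.arc i (φ s) = τ (D.arc i s) := by
    intro s hs
    obtain ⟨t, ht, e⟩ := h s hs
    have : φ s = t := by simp only [φ, ← e, hps t ht]
    rw [this]
    exact ⟨ht, e⟩
  have hφc : ContinuousOn φ (Ioo 0 1) :=
    hp.comp (τ.continuous.comp (D.continuous_arc i)).continuousOn fun s hs => by
      obtain ⟨t, ht, e⟩ := h s hs
      exact ⟨t, ht, e⟩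
  have hhalf : (1 / 2 : ℝ) ∈ Ioo (0 : ℝ) 1 := by norm_num
  obtain ⟨hm, e⟩ := hφ _ hhalf
  have hinv : φ (φ (1 / 2)) = 1 / 2 := by
    change p (τ (D.arc i (φ (1 / 2)))) = 1 / 2
    rw [e, hτ.involutive, hps _ hhalf]
  have hd : ContinuousOn (fun s => φ s - s) (Ioo 0 1) := hφc.sub continuousOn_id
  have hzero : (0 : ℝ) ∈ (fun s => φ s - s) '' Ioo 0 1 := by
    have hord := (isPreconnected_Ioo.image _ hd).ordConnected
    have ha : φ (1 / 2) - 1 / 2 ∈ (fun s => φ s - s) '' Ioo 0 1 := ⟨_, hhalf, rfl⟩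
    have hb : 1 / 2 - φ (1 / 2) ∈ (fun s => φ s - s) '' Ioo 0 1 := ⟨_, hm, by simp only [hinv]⟩
    rcases le_total (φ (1 / 2)) (1 / 2) with hle | hle
    · exact hord.out ha hb ⟨by linarith, by linarith⟩
    · exact hord.out hb ha ⟨by linarith, by linarith⟩
  obtain ⟨s, hs, hs0⟩ := hzero
  have hfix : φ s = s := sub_eq_zero.1 hs0
  have := (hφ s hs).2
  rw [hfix] at this
  exact hτ.free _ this.symm

/-- If the vertices are permuted by a free involution, then the arcs can be parametrized so that
the involution exchanges them in pairs. -/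
theorem exists_equivariant {X : Type u} [TopologicalSpace X] [T2Space X] {V : Set X} {ι : Type}
    [Finite ι] (D : ArcDecomposition X V ι) {τ : C(X, X)} (hτ : IsFreeInvolution τ)
    (hV : ∀ x ∈ V, τ x ∈ V) :
    ∃ (κ : Type) (_ : Finite κ) (E : ArcDecomposition X V (κ × Bool)),
      ∀ k s, E.arc (k, true) s = τ (E.arc (k, false) s) := by
  have hV' : ∀ x ∉ V, τ x ∉ V := fun x hx h => hx (hτ.involutive x ▸ hV _ h)
  choose pair hpair using D.exists_mapsTo_arc τ.continuous hV'
  have hhalf : (1 / 2 : ℝ) ∈ Ioo (0 : ℝ) 1 := by norm_num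
  have hpair_inv : ∀ i, pair (pair i) = i := by
    intro i
    obtain ⟨t, ht, e⟩ := hpair i _ hhalf
    obtain ⟨r, hr, e'⟩ := hpair (pair i) t ht
    rw [e, hτ.involutive] at e'
    exact (D.arc_injective _ _ r hr _ hhalf e').1
  have hpair_ne : ∀ i, pair i ≠ i := by
    intro i hi
    have := hpair i
    rw [hi] at this
    exact D.not_mapsTo_arc_self hτ i this
  obtain ⟨n, ⟨e⟩⟩ := Finite.exists_equiv_fin ι
  -- from each pair of arcs choose the one with the smaller index
  let κ := {i : ι // e i < e (pair i)}
  refine ⟨κ, inferInstance, {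
    arc := fun k s => bif k.2 then τ (D.arc k.1.1 s) else D.arc k.1.1 s
    continuous_arc := ?_
    finite_vertices := D.finite_vertices
    arc_zero_mem := ?_
    arc_one_mem := ?_
    arc_notMem := ?_
    arc_injective := ?_
    exists_arc := ?_ }, fun k s => rfl⟩
  · rintro ⟨k, _ | _⟩
    exacts [D.continuous_arc k.1, τ.continuous.comp (D.continuous_arc k.1)]
  · rintro ⟨k, _ | _⟩
    exacts [D.arc_zero_mem k.1, hV _ (D.arc_zero_mem k.1)]
  · rintro ⟨k, _ | _⟩
    exacts [D.arc_one_mem k.1, hV _ (D.arc_one_mem k.1)]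
  · rintro ⟨k, _ | _⟩ s hs
    exacts [D.arc_notMem k.1 s hs, hV' _ (D.arc_notMem k.1 s hs)]
  · have mixed : ∀ k l : κ, ∀ s ∈ Ioo (0 : ℝ) 1, ∀ t ∈ Ioo (0 : ℝ) 1,
        D.arc k.1 s ≠ τ (D.arc l.1 t) := by
      intro k l s hs t ht h
      obtain ⟨r, hr, e'⟩ := hpair l.1 t ht
      have hk := (D.arc_injective _ _ r hr s hs (e'.trans h.symm)).1
      have h1 := k.2
      have h2 := l.2
      rw [← hk, hpair_inv] at h1
      exact lt_asymm h1 h2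
    have same : ∀ k l : κ, ∀ s ∈ Ioo (0 : ℝ) 1, ∀ t ∈ Ioo (0 : ℝ) 1,
        D.arc k.1 s = D.arc l.1 t → k = l ∧ s = t := by
      intro k l s hs t ht h
      obtain ⟨hk, hst⟩ := D.arc_injective _ _ s hs t ht h
      exact ⟨Subtype.ext hk, hst⟩
    rintro ⟨k, _ | _⟩ ⟨l, _ | _⟩ s hs t ht h
    · obtain ⟨rfl, rfl⟩ := same k l s hs t ht h
      exact ⟨rfl, rfl⟩
    · exact (mixed k l s hs t ht h).elim
    · exact (mixed l k t ht s hs h.symm).elim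
    · have h' : τ (D.arc k.1 s) = τ (D.arc l.1 t) := h
      obtain ⟨rfl, rfl⟩ := same k l s hs t ht (by
        rw [← hτ.involutive (D.arc k.1 s), h', hτ.involutive])
      exact ⟨rfl, rfl⟩
  · intro x hx
    obtain ⟨i, s, hs, rfl⟩ := D.exists_arc x hx
    rcases lt_or_gt_of_ne (fun h => hpair_ne i (e.injective h).symm : e i ≠ e (pair i)) with h | h
    · exact ⟨(⟨i, h⟩, false), s, hs, rfl⟩
    · obtain ⟨t, ht, e'⟩ := hpair i s hs
      refine ⟨(⟨pair i, by rwa [hpair_inv]⟩, true), t, ht, ?_⟩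
      change τ (D.arc (pair i) t) = _
      rw [e', hτ.involutive]

end ArcDecomposition

/-! ### Homotopies assembled from the arcs -/

namespace ArcDecomposition

variable {X : Type u} [TopologicalSpace X] {V : Set X} {ι : Type*} {Y : Type*} [TopologicalSpace Y]

/-- Homotopy extension: a homotopy of the restriction of `f` to the vertices extends to `X`. -/
theorem exists_homotopy_extension (D : ArcDecomposition X V ι) [Finite ι] [T2Space X] (f : C(X, Y))
    (p : X → ℝ → Y) (hp : ∀ v, Continuous (p v)) (hp0 : ∀ v, p v 0 = f v) :
    ∃ H : C(X × I, Y), (∀ x, H (x, 0) = f x) ∧ ∀ v ∈ V, ∀ t : I, H (v, t) = p v t := by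
  -- the arc `i`, mapped by `f` and preceded and followed by the tracks of its end points
  let q : ι → ℝ → Y := fun i u =>
    if u ≤ 0 then p (D.arc i 0) (-u) else if u ≤ 1 then f (D.arc i u) else p (D.arc i 1) (u - 1)
  have hq : ∀ i, Continuous (q i) := by
    intro i
    refine Continuous.if_le ((hp _).comp continuous_neg) (Continuous.if_le
      (f.continuous.comp (D.continuous_arc i)) ((hp _).comp (by fun_prop)) continuous_id
      continuous_const ?_) continuous_id continuous_const ?_
    · rintro u rfl
      simp [hp0]
    · rintro u rfl
      simp [hp0]
  have hqf : ∀ i, ∀ s ∈ Icc (0 : ℝ) 1, q i s = f (D.arc i s) := by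
    intro i s hs
    rcases hs.1.eq_or_lt with rfl | h
    · simp [q, hp0]
    · simp only [q, if_neg (not_le.2 h), if_pos hs.2]
  obtain ⟨H, hH, hHV⟩ := D.exists_glue (T := I) (fun i s t => q i (s * (1 + 2 * t) - t))
    (fun i => (hq i).comp (by fun_prop)) (fun v t => p v t)
    (fun v _ => (hp v).comp continuous_subtype_val)
    (fun i t => by
      have e : (0 : ℝ) * (1 + 2 * t) - t = -t := by ring
      simp only [e, q]
      rw [if_pos (neg_nonpos.2 t.2.1), neg_neg])
    (fun i t => by
      have h0 := t.2.1
      have e : (1 : ℝ) * (1 + 2 * t) - t = 1 + t := by ring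
      simp only [e, q]
      rw [if_neg (by linarith)]
      split_ifs with h
      · have : (t : ℝ) = 0 := le_antisymm (by linarith) h0
        simp [this, hp0]
      · rw [add_sub_cancel_left])
  refine ⟨H, fun x => ?_, hHV⟩
  rcases D.mem_or_exists_arc x with hV | ⟨i, s, hs, rfl⟩
  · rw [hHV x hV]
    exact hp0 x
  · have hs' := Ioo_subset_Icc_self hs
    rw [hH i s hs', ← hqf i s hs']
    simp

/-- The closed arc `i` as a path between its end points. -/
def arcPath (D : ArcDecomposition X V ι) (i : ι) : Path (D.arc i 0) (D.arc i 1) where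
  toFun s := D.arc i s
  continuous_toFun := (D.continuous_arc i).comp continuous_subtype_val
  source' := by simp
  target' := by simp

/-- A map can be changed on every arc to a homotopic path, by a homotopy relative to the
vertices. -/
theorem exists_homotopicRel (D : ArcDecomposition X V ι) [Finite ι] [T2Space X] (f : C(X, Y))
    (γ : ∀ i, Path (f (D.arc i 0)) (f (D.arc i 1)))
    (hγ : ∀ i, ((D.arcPath i).map f.continuous).Homotopic (γ i)) :
    ∃ g : C(X, Y), ContinuousMap.HomotopicRel f g V ∧ ∀ i, ∀ s : I, g (D.arc i s) = γ i s := by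
  let F := fun i => Classical.choice (hγ i)
  obtain ⟨H, hH, hHV⟩ := D.exists_glue (T := I)
    (fun i s t => F i (t, projIcc 0 1 zero_le_one s))
    (fun i => (F i).continuous.comp
      (continuous_snd.prodMk (continuous_projIcc.comp continuous_fst)))
    (fun v _ => f v) (fun _ _ => continuous_const)
    (fun i t => by rw [projIcc_left]; exact (F i).source t)
    (fun i t => by rw [projIcc_right]; exact (F i).target t)
  have hH' : ∀ i, ∀ s t : I, H (D.arc i s, t) = F i (t, s) := fun i s t => by
    rw [hH i s s.2 t, projIcc_val]
  have hx0 : ∀ x, H (x, 0) = f x := by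
    intro x
    rcases D.mem_or_exists_arc x with hV | ⟨i, s, hs, rfl⟩
    · exact hHV x hV 0
    · rw [hH' i ⟨s, Ioo_subset_Icc_self hs⟩ 0]
      exact (F i).apply_zero _
  refine ⟨H.comp ⟨fun x => (x, 1), by fun_prop⟩, ⟨{
    toFun := fun z => H (z.2, z.1)
    continuous_toFun := by fun_prop
    map_zero_left := hx0
    map_one_left := fun x => rfl
    prop' := fun t x hx => hHV x hx t }⟩, fun i s => ?_⟩
  change H (D.arc i s, 1) = _
  rw [hH' i s 1]
  simp

end ArcDecomposition

/-- The points of each orbit of a free involution can be told apart by a two-valued function. -/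
theorem IsFreeInvolution.exists_labelling {X : Type u} [TopologicalSpace X] {τ : C(X, X)}
    (hτ : IsFreeInvolution τ) : ∃ b : X → Bool, ∀ x, b (τ x) = !b x := by
  classical
  let _ : LinearOrder X := linearOrderOfSTO (WellOrderingRel (α := X))
  refine ⟨fun x => decide (x < τ x), fun x => ?_⟩
  simp only [hτ.involutive]
  rcases lt_or_gt_of_ne (hτ.free x) with h | h
  · simp [h, h.not_gt]
  · simp [h, h.not_gt]

/-- A map from a finite graph with a free involution `τ` to a space with a passing place is
homotopic, relative to a given point, to a map `g` with `g x ≠ g (τ x)` for all `x`. -/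
theorem IsPassingPlace.exists_homotopicRel_forall_ne {X : Type u} {Y : Type v} [TopologicalSpace X]
    [TopologicalSpace Y] [T2Space Y] [PathConnectedSpace Y] {U : Set Y} {c : Y}
    (hU : IsPassingPlace U c) (hX : IsFiniteGraph X) {τ : C(X, X)} (hτ : IsFreeInvolution τ)
    (x₀ : X) (f : C(X, Y)) :
    ∃ g : C(X, Y), ContinuousMap.HomotopicRel f g {x₀} ∧ ∀ x, g x ≠ g (τ x) := by
  classical
  have := hX.t2Space
  obtain ⟨V₀, n, ⟨D₀⟩⟩ := hX.exists_arcDecomposition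
  obtain ⟨κ₀, _, ⟨D₁⟩⟩ := D₀.exists_union (W := {x₀} ∪ τ '' ({x₀} ∪ V₀))
    ((finite_singleton x₀).union (((finite_singleton x₀).union D₀.finite_vertices).image τ))
  set V : Set X := {x₀} ∪ τ '' ({x₀} ∪ V₀) ∪ V₀ with hVdef
  have hV : ∀ x ∈ V, τ x ∈ V := by
    rintro x ((hx | ⟨z, hz, rfl⟩) | hx)
    · exact .inl (.inr ⟨x, .inl hx, rfl⟩)
    · rw [hτ.involutive]
      rcases hz with hz | hz
      exacts [.inl (.inl hz), .inr hz]
    · exact .inl (.inr ⟨x, .inr hx, rfl⟩)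
  have hx₀ : x₀ ∈ V := .inl (.inl rfl)
  obtain ⟨κ, _, D, hD⟩ := D₁.exists_equivariant hτ hV
  -- make the values at `v` and `τ v` distinct for all vertices `v`
  obtain ⟨b, hb⟩ := hτ.exists_labelling
  obtain ⟨y₁, -, hy₁⟩ := hU.exists_ne (f x₀)
  let a : X → Y := fun x => if b x = b x₀ then f x₀ else y₁
  have ha : ∀ x, a x ≠ a (τ x) := by
    intro x
    simp only [a, hb]
    cases b x <;> cases b x₀ <;> simp [hy₁, hy₁.symm]
  let p : X → ℝ → Y := fun x =>
    if f x = a x then fun _ => f x else (PathConnectedSpace.somePath (f x) (a x)).extend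
  have hp : ∀ x, Continuous (p x) := by
    intro x
    by_cases h : f x = a x
    · simp only [p, if_pos h]; exact continuous_const
    · simp only [p, if_neg h]; exact Path.continuous_extend _
  have hp0 : ∀ x, p x 0 = f x := by
    intro x
    by_cases h : f x = a x
    · simp only [p, if_pos h]
    · simp only [p, if_neg h]; simp
  have hp1 : ∀ x, p x 1 = a x := by
    intro x
    by_cases h : f x = a x
    · simp only [p, if_pos h]; exact h
    · simp only [p, if_neg h]; simp
  have hpx₀ : ∀ t, p x₀ t = f x₀ := by
    intro t
    have h : f x₀ = a x₀ := by simp [a]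
    simp only [p, if_pos h]
  obtain ⟨H, hH0, hHV⟩ := D.exists_homotopy_extension f p hp hp0
  let f₁ : C(X, Y) := H.comp ⟨fun x => (x, 1), by fun_prop⟩
  have hf₁ : ∀ v ∈ V, f₁ v = a v := fun v hv => (hHV v hv 1).trans (by simpa using hp1 v)
  have hrel : ContinuousMap.HomotopicRel f f₁ {x₀} := ⟨{
    toFun := fun z => H (z.2, z.1)
    continuous_toFun := by fun_prop
    map_zero_left := hH0
    map_one_left := fun x => rfl
    prop' := by
      rintro t x rfl
      exact (hHV x hx₀ t).trans (hpx₀ t) }⟩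
  -- the two arcs of each pair are mapped to a pair of homotopic paths without collisions
  have hpair : ∀ k : κ, ∃ (γ : ∀ b : Bool, Path (f₁ (D.arc (k, b) 0)) (f₁ (D.arc (k, b) 1))),
      (∀ b, ((D.arcPath (k, b)).map f₁.continuous).Homotopic (γ b)) ∧
      ∀ t, γ false t ≠ γ true t := by
    intro k
    have hne : ∀ s, D.arc (k, false) s ∈ V → f₁ (D.arc (k, false) s) ≠ f₁ (D.arc (k, true) s) := by
      intro s hs
      rw [hD, hf₁ _ hs, hf₁ _ (hV _ hs)]
      exact ha _
    obtain ⟨γ, δ, h1, h2, h3⟩ := hU.separable (hne 0 (D.arc_zero_mem _)) (hne 1 (D.arc_one_mem _))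
      (Path.Homotopic.Quotient.mk ((D.arcPath (k, false)).map f₁.continuous))
      (Path.Homotopic.Quotient.mk ((D.arcPath (k, true)).map f₁.continuous))
    refine ⟨fun b => Bool.rec γ δ b, ?_, h3⟩
    rintro (_ | _)
    exacts [(Path.Homotopic.Quotient.exact h1).symm, (Path.Homotopic.Quotient.exact h2).symm]
  choose γ hγ hγne using hpair
  obtain ⟨g, hg, hgγ⟩ := D.exists_homotopicRel f₁ (fun i => γ i.1 i.2) (fun i => hγ i.1 i.2)
  have hgV : ∀ v ∈ V, g v = f₁ v := fun v hv => ((Classical.choice hg).fst_eq_snd hv).symm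
  refine ⟨g, hrel.trans ?_, fun x => ?_⟩
  · obtain ⟨F⟩ := hg
    exact ⟨{ F.toHomotopy with
      prop' := by
        rintro t x rfl
        exact F.prop' t x hx₀ }⟩
  · have hpt : ∀ k, ∀ s ∈ Ioo (0 : ℝ) 1, g (D.arc (k, false) s) ≠ g (D.arc (k, true) s) := by
      intro k s hs
      have hs' := Ioo_subset_Icc_self hs
      rw [show g (D.arc (k, false) s) = γ k false ⟨s, hs'⟩ from hgγ (k, false) ⟨s, hs'⟩,
        show g (D.arc (k, true) s) = γ k true ⟨s, hs'⟩ from hgγ (k, true) ⟨s, hs'⟩]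
      exact hγne k _
    rcases D.mem_or_exists_arc x with hx | ⟨⟨k, _ | _⟩, s, hs, rfl⟩
    · rw [hgV x hx, hgV _ (hV x hx), hf₁ x hx, hf₁ _ (hV x hx)]
      exact ha x
    · rw [← hD]
      exact hpt k s hs
    · rw [hD, hτ.involutive, ← hD]
      exact (hpt k s hs).symm

theorem theorem1p2 {Γ : Type u} {G : Type v} [TopologicalSpace Γ] [TopologicalSpace G]
    [ConnectedSpace Γ] [ConnectedSpace G] [Nontrivial G]
    (hΓ : IsFiniteGraph Γ) (hG : IsFiniteGraph G)
    (τ : C(Γ, Γ)) (hτ : IsFreeInvolution τ)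
    (hcircle : ¬ Nonempty (G ≃ₜ Circle)) (hinterval : ¬ Nonempty (G ≃ₜ unitInterval))
    (x₀ : Γ) (y₀ : G) (α : BasedHomotopyClass Γ x₀ G y₀) :
    ¬ BorsukUlamProperty τ α ∧
      ∃ f : BasedMap Γ x₀ G y₀, f.Represents α ∧ ∀ x : Γ, f.1 x ≠ f.1 (τ x) := by
  suffices h : ∃ f : BasedMap Γ x₀ G y₀, f.Represents α ∧ ∀ x : Γ, f.1 x ≠ f.1 (τ x) by
    refine ⟨fun hBU => ?_, h⟩
    obtain ⟨f, hf, hne⟩ := h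
    obtain ⟨x, hx⟩ := hBU f hf
    exact hne x hx
  have := hG.t2Space
  obtain ⟨V, n, ⟨D⟩⟩ := hG.exists_arcDecomposition
  have := D.pathConnectedSpace
  obtain ⟨W, κ, _, E, v, hv⟩ := D.exists_isEssential hcircle hinterval
  obtain ⟨U, hU⟩ := hv.exists_isPassingPlace
  induction α using Quotient.inductionOn with
  | h f =>
    obtain ⟨g, hfg, hg⟩ := hU.exists_homotopicRel_forall_ne hΓ hτ x₀ f.1
    have hgx : g x₀ = y₀ := by
      rw [← f.2]
      exact ((Classical.choice hfg).fst_eq_snd rfl).symm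
    exact ⟨⟨g, hgx⟩, Quotient.sound hfg.symm, hg⟩
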